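/- Let $b_0,b_1>0$. Let $\mathcal X=L^2(0,1)\times\mathbb R^2$ be the real Hilbert space with inner product $\langle (u,\alpha),(v,\beta)\rangle=\int_0^1 uv\,dx+\alpha_0\beta_0+\alpha_1\beta_1$. Put $A_m u=u''$ for $u\in H^2(0,1)$, $Lu=(u(0),u(1))$ for $u\in H^1(0,1)$, $Cu=(u'(0),-u'(1))$ for $u\in H^2(0,1)$, $B=\mathrm{diag}(-b_0,-b_1)$, where $u(0),u(1),u'(0),u'(1)$ are values of the continuous representatives on $[0,1]$, and let $\mathbb A$ be the operator on $\mathcal X$ given by $$\mathbb A\begin{pmatrix}u\\v\end{pmatrix}=\begin{pmatrix}A_m&0\\C&B\end{pmatrix}\begin{pmatrix}u\\v\end{pmatrix}=\begin{pmatrix}u''\\Cu+Bv\end{pmatrix},\qquad D(\mathbb A)=\{(u,v)\in H^2(0,1)\times\mathbb R^2: Lu=v\}.$$ Then: 1. $\mathbb A$ is the infinitesimal generator of a strongly continuous semigroup $(T(t))_{t\ge0}$ of contractions on $\mathcal X$ which is analytic of angle $\pi/2$ (that is, its complexification extends holomorphically to a semigroup on $\{z\neq 0:|\arg z|<\pi/2\}$,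 strongly continuous at $0$ in every sector $\{z\ne 0:|\arg z|<\theta'\}$ with $0<\theta'<\pi/2$); every $T(t)$ is self-adjoint, and $T(t)$ is compact for every $t>0$. 2. $\mathbb A$ is self-adjoint and dissipative and has compact resolvent. 3. The bilinear form $$a\big((u,\alpha),(v,\beta)\big)=\int_0^1u'v'\,dx+b_0u(0)v(0)+b_1u(1)v(1)$$ with domain $V=\{(u,\alpha)\in H^1(0,1)\times\mathbb R^2: u(0)=\alpha_0,\ u(1)=\alpha_1\}$ is densely defined, symmetric, positive (i.e. $a(\mathbf f,\mathbf f)\ge0$), closed (i.e. $V$ is complete for the norm $\|\mathbf f\|_a=(a(\mathbf f,\mathbf f)+\|\mathbf f\|_{\mathcal X}^2)^{1/2}$) and continuous for $\|\cdot\|_a$, and $\mathbb A$ is the operator associated with it: for $\mathbf f,\mathbf g\in\mathcal X$, one has $\mathbf f\in D(\mathbb A)$ and $\mathbb A\mathbf f=-\mathbf g$ if and only if $\mathbf f\in V$ and $a(\mathbf f,\mathbf h)=\langle\mathbf g,\mathbf h\rangle$ for all $\mathbf h\in V$. -/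

import Mathlib

open MeasureTheory Set Filter Topology
open scoped NNReal ContDiff RealInnerProductSpace

noncomputable section

namespace DynBdry

/-! ### Sobolev spaces on the interval `(0,1)` -/

/-- Lebesgue measure on the open interval `(0,1)`. -/
abbrev μI : Measure ℝ := volume.restrict (Ioo (0 : ℝ) 1)

/-- The real Hilbert space `X = L²(0,1)`. -/
abbrev L2I : Type := Lp ℝ 2 μI

/-- The boundary space `ℝ²`, with the Euclidean inner product. -/
abbrev R2 : Type := EuclideanSpace ℝ (Fin 2)

/-- The Hilbert space `L²(0,1) × ℝ²`, with the inner product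
`⟪(u,α),(v,β)⟫ = ∫₀¹ u v dx + α₀ β₀ + α₁ β₁`. -/
abbrev XX : Type := WithLp 2 (L2I × R2)

/-- `g` is the weak (distributional) derivative of `u` on `(0,1)`. -/
def IsWeakDeriv (u g : L2I) : Prop :=
  ∀ φ : ℝ → ℝ, ContDiff ℝ ∞ φ → HasCompactSupport φ → tsupport φ ⊆ Ioo (0 : ℝ) 1 →
    ∫ x, u x * deriv φ x ∂μI = - ∫ x, g x * φ x ∂μI

/-- `c` is, on `[0,1]`, a continuous representative of the class `u`. -/
def IsContRep (u : L2I) (c : ℝ → ℝ) : Prop :=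
  ContinuousOn c (Icc (0 : ℝ) 1) ∧ u =ᵐ[μI] c

theorem L2I.integrable (u : L2I) : Integrable u μI :=
  (Lp.memLp u).integrable (by norm_num)

theorem integrable_mul_of_continuous (u : L2I) {φ : ℝ → ℝ} (hφ : Continuous φ)
    (hc : HasCompactSupport φ) : Integrable (fun x => u x * φ x) μI := by
  obtain ⟨K, hK⟩ := hφ.bounded_above_of_compact_support hc
  exact (L2I.integrable u).mul_bdd (c := K) hφ.aestronglyMeasurable
    (Filter.Eventually.of_forall hK)

theorem L2I.eq_of_test {u v : L2I}
    (h : ∀ φ : ℝ → ℝ, ContDiff ℝ ∞ φ → HasCompactSupport φ → tsupport φ ⊆ Ioo (0 : ℝ) 1 →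
      ∫ x, u x * φ x ∂μI = ∫ x, v x * φ x ∂μI) : u = v := by
  have hint : Integrable (fun x => u x - v x) μI := (L2I.integrable u).sub (L2I.integrable v)
  have := (isOpen_Ioo (a := (0 : ℝ)) (b := 1)).ae_eq_zero_of_integral_contDiff_smul_eq_zero
    (μ := (volume : Measure ℝ)) (f := fun x => u x - v x)
    (IntegrableOn.locallyIntegrableOn hint) (by
      intro φ h1 h2 h3
      have hs : ∫ x, φ x • (u x - v x) = ∫ x, φ x • (u x - v x) ∂μI := by
        symm
        apply setIntegral_eq_integral_of_forall_compl_eq_zero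
        intro x hx
        have : φ x = 0 := by
          by_contra hne
          exact hx (h3 (subset_tsupport φ hne))
        simp [this]
      rw [hs]
      have : (fun x => φ x • (u x - v x)) = fun x => u x * φ x - v x * φ x := by
        ext x; simp only [smul_eq_mul]; ring
      rw [this, integral_sub (integrable_mul_of_continuous u h1.continuous h2)
        (integrable_mul_of_continuous v h1.continuous h2), h φ h1 h2 h3, sub_self])
  apply Lp.ext
  rw [Filter.EventuallyEq, ae_restrict_iff' measurableSet_Ioo]
  filter_upwards [this] with x hx hx'
  linarith [hx hx']

theorem IsWeakDeriv.unique {u g h : L2I} (hg : IsWeakDeriv u g) (hh : IsWeakDeriv u h) :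
    g = h := by
  apply L2I.eq_of_test
  intro φ h1 h2 h3
  have e1 := hg φ h1 h2 h3
  have e2 := hh φ h1 h2 h3
  linarith

theorem IsWeakDeriv.zero : IsWeakDeriv 0 0 := by
  intro φ h1 h2 h3
  have h0 : (⇑(0 : L2I)) =ᵐ[μI] 0 := Lp.coeFn_zero ℝ 2 μI
  rw [integral_eq_zero_of_ae, integral_eq_zero_of_ae, neg_zero]
  all_goals
    filter_upwards [h0] with x hx
    rw [hx, Pi.zero_apply, zero_mul]

theorem IsWeakDeriv.add {u v g h : L2I} (hu : IsWeakDeriv u g) (hv : IsWeakDeriv v h) :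
    IsWeakDeriv (u + v) (g + h) := by
  intro φ h1 h2 h3
  have key : ∀ (a b : L2I) (ψ : ℝ → ℝ), Continuous ψ → HasCompactSupport ψ →
      ∫ x, (a + b) x * ψ x ∂μI = ∫ x, a x * ψ x ∂μI + ∫ x, b x * ψ x ∂μI := by
    intro a b ψ hψ hc
    rw [← integral_add (integrable_mul_of_continuous a hψ hc)
      (integrable_mul_of_continuous b hψ hc)]
    apply integral_congr_ae
    filter_upwards [Lp.coeFn_add a b] with x hx
    rw [hx, Pi.add_apply, add_mul]
  rw [key _ _ _ (h1.continuous_deriv (by simp)) h2.deriv, key _ _ _ h1.continuous h2,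
    hu φ h1 h2 h3, hv φ h1 h2 h3]
  ring

theorem IsWeakDeriv.smul (r : ℝ) {u g : L2I} (hu : IsWeakDeriv u g) :
    IsWeakDeriv (r • u) (r • g) := by
  intro φ h1 h2 h3
  have key : ∀ (a : L2I) (ψ : ℝ → ℝ),
      ∫ x, (r • a) x * ψ x ∂μI = r * ∫ x, a x * ψ x ∂μI := by
    intro a ψ
    rw [← integral_const_mul]
    apply integral_congr_ae
    filter_upwards [Lp.coeFn_smul r a] with x hx
    rw [hx, Pi.smul_apply, smul_eq_mul, mul_assoc]
  rw [key, key, hu φ h1 h2 h3]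
  ring

/-- The Sobolev space `H¹(0,1)`. -/
def H1 : Submodule ℝ L2I where
  carrier := {u | ∃ g, IsWeakDeriv u g}
  add_mem' := by
    rintro u v ⟨g, hg⟩ ⟨h, hh⟩
    exact ⟨_, hg.add hh⟩
  zero_mem' := ⟨0, IsWeakDeriv.zero⟩
  smul_mem' := by
    rintro r u ⟨g, hg⟩
    exact ⟨_, hg.smul r⟩

theorem weakDeriv_exists (u : H1) : ∃ g, IsWeakDeriv u g := u.2

/-- The weak derivative `∂ₓ : H¹(0,1) → L²(0,1)`. -/
def weakDeriv : H1 →ₗ[ℝ] L2I where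
  toFun u := (weakDeriv_exists u).choose
  map_add' u v := ((weakDeriv_exists (u + v)).choose_spec).unique
    ((weakDeriv_exists u).choose_spec.add (weakDeriv_exists v).choose_spec)
  map_smul' r u := ((weakDeriv_exists (r • u)).choose_spec).unique
    ((weakDeriv_exists u).choose_spec.smul r)

theorem weakDeriv_spec (u : H1) : IsWeakDeriv u (weakDeriv u) :=
  (weakDeriv_exists u).choose_spec

/-- The Sobolev space `H²(0,1)`: the functions in `H¹` whose derivative is in `H¹`. -/
def H2 : Submodule ℝ L2I := (H1.comap weakDeriv).map H1.subtype

theorem H2_le_H1 : H2 ≤ H1 := by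
  rintro _ ⟨u, -, rfl⟩
  exact u.2

theorem weakDeriv_mem_H1 (u : H2) : weakDeriv ⟨u, H2_le_H1 u.2⟩ ∈ H1 := by
  obtain ⟨_, ⟨v, hv, rfl⟩⟩ := u
  exact hv

/-- The first derivative as a map `H²(0,1) → H¹(0,1)`. -/
def derivH2 : H2 →ₗ[ℝ] H1 :=
  (weakDeriv ∘ₗ Submodule.inclusion H2_le_H1).codRestrict H1 weakDeriv_mem_H1

/-! ### Boundary values -/

theorem IsContRep.eqOn {u : L2I} {c d : ℝ → ℝ} (hc : IsContRep u c) (hd : IsContRep u d) :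
    EqOn c d (Icc 0 1) := by
  have h : c =ᵐ[μI] d := hc.2.symm.trans hd.2
  apply Measure.eqOn_Icc_of_ae_eq (μ := volume) (by norm_num) _ hc.1 hd.1
  rwa [μI, restrict_Ioo_eq_restrict_Icc] at h

theorem IsContRep.add {u v : L2I} {c d : ℝ → ℝ} (hc : IsContRep u c) (hd : IsContRep v d) :
    IsContRep (u + v) (c + d) :=
  ⟨hc.1.add hd.1, (Lp.coeFn_add u v).trans (hc.2.add hd.2)⟩

theorem IsContRep.smul (r : ℝ) {u : L2I} {c : ℝ → ℝ} (hc : IsContRep u c) :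
    IsContRep (r • u) (r • c) :=
  ⟨hc.1.const_smul r, (Lp.coeFn_smul r u).trans (hc.2.const_smul r)⟩

/-- Every element of `H¹(0,1)` has a representative that is continuous on `[0,1]`. -/
theorem contRep_exists (u : H1) : ∃ c, IsContRep u c := by
  obtain ⟨g, hg⟩ := u.2
  have hgi : IntervalIntegrable g volume 0 1 := by
    rw [intervalIntegrable_iff_integrableOn_Ioo_of_le zero_le_one]
    exact L2I.integrable g
  set G : ℝ → ℝ := fun x => ∫ t in (0 : ℝ)..x, g t with hGdef
  have hGac : AbsolutelyContinuousOnInterval G 0 1 :=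
    hgi.absolutelyContinuousOnInterval_intervalIntegral (by simp)
  have hGc : ContinuousOn G (Icc 0 1) := by
    simpa [uIcc_of_le] using hGac.continuousOn
  have hGd : ∀ᵐ x, x ∈ uIcc (0 : ℝ) 1 → deriv G x = g x := by
    filter_upwards [hgi.ae_hasDerivAt_integral] with x hx hx'
    exact (hx hx' 0 (by simp)).deriv
  have conv : ∀ f : ℝ → ℝ, ∫ x, f x ∂μI = ∫ x in (0 : ℝ)..1, f x := by
    intro f
    rw [intervalIntegral.integral_of_le zero_le_one, integral_Ioc_eq_integral_Ioo]
  have hGint : Integrable G μI := by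
    have := hGc.integrableOn_Icc (μ := volume)
    exact this.mono_set Ioo_subset_Icc_self
  -- integration by parts against a test function
  have hparts : ∀ φ : ℝ → ℝ, ContDiff ℝ ∞ φ → HasCompactSupport φ →
      tsupport φ ⊆ Ioo (0 : ℝ) 1 →
      ∫ x, G x * deriv φ x ∂μI = - ∫ x, g x * φ x ∂μI := by
    intro φ h1 h2 h3
    have hφac : AbsolutelyContinuousOnInterval φ 0 1 :=
      (h1.of_le (by simp)).contDiffOn.absolutelyContinuousOnInterval
    have z0 : φ 0 = 0 := by
      by_contra h; exact absurd (h3 (subset_tsupport φ h)).1 (lt_irrefl _)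
    have z1 : φ 1 = 0 := by
      by_contra h; exact absurd (h3 (subset_tsupport φ h)).2 (lt_irrefl _)
    rw [conv, conv, hGac.integral_mul_deriv_eq_deriv_mul hφac, z0, z1]
    have : ∫ x in (0 : ℝ)..1, deriv G x * φ x = ∫ x in (0 : ℝ)..1, g x * φ x := by
      apply intervalIntegral.integral_congr_ae
      filter_upwards [hGd] with x hx hx'
      rw [hx (uIoc_subset_uIcc hx')]
    rw [this]; ring
  -- a normalised bump
  obtain ⟨ψ, hψ1, hψ2, hψ3, hψ4⟩ : ∃ ψ : ℝ → ℝ, ContDiff ℝ ∞ ψ ∧ HasCompactSupport ψ ∧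
      tsupport ψ ⊆ Ioo (0 : ℝ) 1 ∧ ∫ x, ψ x = 1 := by
    let f : ContDiffBump (1 / 2 : ℝ) := ⟨1 / 8, 1 / 4, by norm_num, by norm_num⟩
    refine ⟨f.normed volume, f.contDiff_normed, f.hasCompactSupport_normed, ?_,
      f.integral_normed⟩
    rw [f.tsupport_normed_eq, Real.closedBall_eq_Icc]
    intro x hx
    have h1 := hx.1
    have h2 := hx.2
    simp only [f] at h1 h2
    constructor <;> linarith
  have hfull : ∀ f : ℝ → ℝ, tsupport f ⊆ Ioo (0 : ℝ) 1 → ∫ x, f x ∂μI = ∫ x, f x := by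
    intro f hf
    apply setIntegral_eq_integral_of_forall_compl_eq_zero
    intro x hx
    by_contra hne
    exact hx (hf (subset_tsupport f hne))
  have hw : ∀ φ : ℝ → ℝ, Continuous φ → HasCompactSupport φ →
      Integrable (fun x => ((u : L2I) x - G x) * φ x) μI := by
    intro φ h1 h2
    obtain ⟨K, hK⟩ := h1.bounded_above_of_compact_support h2
    exact ((L2I.integrable u).sub hGint).mul_bdd (c := K) h1.aestronglyMeasurable
      (Filter.Eventually.of_forall hK)
  -- `u - G` has vanishing weak derivative
  have hzero : ∀ φ : ℝ → ℝ, ContDiff ℝ ∞ φ → HasCompactSupport φ →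
      tsupport φ ⊆ Ioo (0 : ℝ) 1 → ∫ x, ((u : L2I) x - G x) * deriv φ x ∂μI = 0 := by
    intro φ h1 h2 h3
    have hd : Continuous (deriv φ) := h1.continuous_deriv (by simp)
    obtain ⟨K, hK⟩ := hd.bounded_above_of_compact_support h2.deriv
    simp only [sub_mul]
    rw [integral_sub (integrable_mul_of_continuous u hd h2.deriv)
      (hGint.mul_bdd (c := K) hd.aestronglyMeasurable (Filter.Eventually.of_forall hK)),
      hg φ h1 h2 h3, hparts φ h1 h2 h3, sub_self]
  set k : ℝ := ∫ x, ((u : L2I) x - G x) * ψ x ∂μI with hk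
  have hmain : ∀ φ : ℝ → ℝ, ContDiff ℝ ∞ φ → HasCompactSupport φ →
      tsupport φ ⊆ Ioo (0 : ℝ) 1 →
      ∫ x, ((u : L2I) x - G x) * φ x ∂μI = k * ∫ x, φ x := by
    intro φ h1 h2 h3
    set m : ℝ := ∫ x, φ x with hm
    set η : ℝ → ℝ := fun x => φ x - m * ψ x with hη
    have hηs : ContDiff ℝ ∞ η := h1.sub (contDiff_const.mul hψ1)
    -- a compact interval carrying both supports
    obtain ⟨a, c, ha, hc, hac, hsupp⟩ : ∃ a c : ℝ, 0 < a ∧ c < 1 ∧ a ≤ c ∧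
        ∀ x, x ∉ Icc a c → η x = 0 := by
      have hK : IsCompact (tsupport φ ∪ tsupport ψ ∪ {1 / 2}) :=
        (h2.isCompact.union hψ2.isCompact).union isCompact_singleton
      have hKs : tsupport φ ∪ tsupport ψ ∪ {1 / 2} ⊆ Ioo (0 : ℝ) 1 := by
        refine union_subset (union_subset h3 hψ3) ?_
        rw [singleton_subset_iff]; constructor <;> norm_num
      have hne : (tsupport φ ∪ tsupport ψ ∪ {1 / 2} : Set ℝ).Nonempty := ⟨1 / 2, by simp⟩
      obtain ⟨a, haK, ha⟩ := hK.exists_isLeast hne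
      obtain ⟨c, hcK, hc⟩ := hK.exists_isGreatest hne
      refine ⟨a, c, (hKs haK).1, (hKs hcK).2, ha hcK, ?_⟩
      intro x hx
      have hx' : x ∉ tsupport φ ∪ tsupport ψ ∪ {1 / 2} := fun h => hx ⟨ha h, hc h⟩
      simp only [mem_union, not_or] at hx'
      rw [hη]
      simp only
      rw [image_eq_zero_of_notMem_tsupport hx'.1.1, image_eq_zero_of_notMem_tsupport hx'.1.2]
      ring
    have hηc : HasCompactSupport η := HasCompactSupport.intro isCompact_Icc hsupp
    have hηi : ∫ x, η x = 0 := by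
      rw [hη, integral_sub (h1.continuous.integrable_of_hasCompactSupport h2)
        ((hψ1.continuous.integrable_of_hasCompactSupport hψ2).const_mul m),
        integral_const_mul, hψ4, hm]
      ring
    set Φ : ℝ → ℝ := fun x => ∫ t in (0 : ℝ)..x, η t with hΦ
    have hΦd : ∀ x, HasDerivAt Φ (η x) x := fun x =>
      intervalIntegral.integral_hasDerivAt_right
        (hηs.continuous.intervalIntegrable _ _)
        (hηs.continuous.stronglyMeasurableAtFilter _ _) hηs.continuous.continuousAt
    have hΦe : deriv Φ = η := funext fun x => (hΦd x).deriv
    have hΦs : ContDiff ℝ ∞ Φ := by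
      rw [contDiff_infty_iff_deriv]
      exact ⟨fun x => (hΦd x).differentiableAt, hΦe ▸ hηs⟩
    have hΦ0 : ∀ x, x ∉ Icc a c → Φ x = 0 := by
      intro x hx
      rw [mem_Icc, not_and_or, not_le, not_le] at hx
      rcases hx with hx | hx
      · apply intervalIntegral.integral_zero_ae
        refine Filter.Eventually.of_forall fun t ht => hsupp t fun ht' => ?_
        rcases mem_uIoc.1 ht with h | h
        · linarith [ht'.1, h.2]
        · linarith [ht'.1, h.2]
      · have hx0 : 0 ≤ x := by linarith
        simp only [hΦ]
        rw [intervalIntegral.integral_of_le hx0,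
          setIntegral_eq_integral_of_forall_compl_eq_zero, hηi]
        intro t ht
        apply hsupp
        intro ht'
        exact ht ⟨lt_of_lt_of_le ha ht'.1, by linarith [ht'.2]⟩
    have hΦc : HasCompactSupport Φ := HasCompactSupport.intro isCompact_Icc hΦ0
    have hΦt : tsupport Φ ⊆ Ioo (0 : ℝ) 1 := by
      have : tsupport Φ ⊆ Icc a c := by
        apply closure_minimal _ isClosed_Icc
        intro x hx
        by_contra h
        exact hx (hΦ0 x h)
      exact this.trans fun x hx => ⟨lt_of_lt_of_le ha hx.1, lt_of_le_of_lt hx.2 hc⟩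
    have := hzero Φ hΦs hΦc hΦt
    rw [hΦe] at this
    have hexp : (fun x => ((u : L2I) x - G x) * η x) =
        fun x => ((u : L2I) x - G x) * φ x - m * (((u : L2I) x - G x) * ψ x) := by
      ext x; simp only [hη]; ring
    rw [hexp, integral_sub (hw φ h1.continuous h2) ((hw ψ hψ1.continuous hψ2).const_mul m),
      integral_const_mul] at this
    linarith
  refine ⟨fun x => G x + k, hGc.add continuousOn_const, ?_⟩
  have hint : Integrable (fun x => (u : L2I) x - G x - k) μI :=
    ((L2I.integrable u).sub hGint).sub (integrable_const k)
  have hfin := (isOpen_Ioo (a := (0 : ℝ)) (b := 1)).ae_eq_zero_of_integral_contDiff_smul_eq_zero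
    (μ := (volume : Measure ℝ)) (f := fun x => (u : L2I) x - G x - k)
    (IntegrableOn.locallyIntegrableOn hint) (by
      intro φ h1 h2 h3
      have hs : ∫ x, φ x • ((u : L2I) x - G x - k) =
          ∫ x, φ x • ((u : L2I) x - G x - k) ∂μI := by
        symm
        apply setIntegral_eq_integral_of_forall_compl_eq_zero
        intro x hx
        have : φ x = 0 := by
          by_contra hne
          exact hx (h3 (subset_tsupport φ hne))
        simp [this]
      have he : (fun x => φ x • ((u : L2I) x - G x - k)) =
          fun x => ((u : L2I) x - G x) * φ x - k * φ x := by
        ext x; simp only [smul_eq_mul]; ring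
      have hφi : Integrable φ volume := h1.continuous.integrable_of_hasCompactSupport h2
      rw [hs, he, integral_sub (hw φ h1.continuous h2) (hφi.restrict.const_mul k),
        integral_const_mul, hmain φ h1 h2 h3, hfull φ h3, sub_self])
  rw [Filter.EventuallyEq, ae_restrict_iff' measurableSet_Ioo]
  filter_upwards [hfin] with x hx hx'
  linarith [hx hx']

/-- The continuous representative on `[0,1]` of an element of `H¹(0,1)`. -/
def contRep (u : H1) : ℝ → ℝ := (contRep_exists u).choose

theorem contRep_spec (u : H1) : IsContRep u (contRep u) := (contRep_exists u).choose_spec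

/-- Evaluation of (the continuous representative of) `u ∈ H¹(0,1)` at a point of `[0,1]`. -/
def evalAt (x : Icc (0 : ℝ) 1) : H1 →ₗ[ℝ] ℝ where
  toFun u := contRep u x
  map_add' u v := (contRep_spec (u + v)).eqOn ((contRep_spec u).add (contRep_spec v)) x.2
  map_smul' r u := (contRep_spec (r • u)).eqOn ((contRep_spec u).smul r) x.2

/-- The left endpoint `0` of `[0,1]`. -/
def pt0 : Icc (0 : ℝ) 1 := ⟨0, by norm_num⟩

/-- The right endpoint `1` of `[0,1]`. -/
def pt1 : Icc (0 : ℝ) 1 := ⟨1, by norm_num⟩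

/-! ### The matrix operator -/

/-- `A_m = ∂ₓ²` with domain `H²(0,1)`. -/
def Am : H2 →ₗ[ℝ] L2I := weakDeriv ∘ₗ derivH2

/-- The boundary evaluation operator `L u = (u(0), u(1))`. -/
def L : H1 →ₗ[ℝ] R2 where
  toFun u := !₂[evalAt pt0 u, evalAt pt1 u]
  map_add' u v := by ext i; fin_cases i <;> simp
  map_smul' r u := by ext i; fin_cases i <;> simp

/-- The feedback operator `C u = (∂ₓ u(0), -∂ₓ u(1))`. -/
def C : H2 →ₗ[ℝ] R2 where
  toFun u := !₂[evalAt pt0 (derivH2 u), - evalAt pt1 (derivH2 u)]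
  map_add' u v := by
    simp only [map_add]
    generalize evalAt pt0 (derivH2 u) = p, evalAt pt0 (derivH2 v) = q
    generalize evalAt pt1 (derivH2 u) = r, evalAt pt1 (derivH2 v) = s
    ext i; fin_cases i <;> simp [add_comm]
  map_smul' r u := by
    simp only [map_smul]
    generalize evalAt pt0 (derivH2 u) = p, evalAt pt1 (derivH2 u) = q
    ext i; fin_cases i <;> simp

/-- `B = diag(-b₀, -b₁)`, acting on `ℝ²`. -/
def B (b : Fin 2 → ℝ) : R2 →ₗ[ℝ] R2 := (Matrix.diagonal (fun i => - b i)).toEuclideanLin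

/-- The domain `D(𝔸) = {(u,v) ∈ H²(0,1) × ℝ² : L u = v}`. -/
def domA : Submodule ℝ XX where
  carrier := {w | ∃ h : w.fst ∈ H2, L ⟨w.fst, H2_le_H1 h⟩ = w.snd}
  add_mem' := by
    rintro w z ⟨hw, hw'⟩ ⟨hz, hz'⟩
    refine ⟨H2.add_mem hw hz, ?_⟩
    rw [WithLp.add_snd, ← hw', ← hz', ← map_add]
    rfl
  zero_mem' := ⟨H2.zero_mem, map_zero L⟩
  smul_mem' := by
    rintro r w ⟨hw, hw'⟩
    refine ⟨H2.smul_mem r hw, ?_⟩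
    rw [WithLp.smul_snd, ← hw', ← map_smul]
    rfl

/-- The first component of an element of `D(𝔸)`, as an element of `H²(0,1)`. -/
def domA.fst : domA →ₗ[ℝ] H2 where
  toFun w := ⟨(w : XX).fst, w.2.1⟩
  map_add' _ _ := rfl
  map_smul' _ _ := rfl

/-- The second component of an element of `D(𝔸)`. -/
def domA.snd : domA →ₗ[ℝ] R2 where
  toFun w := (w : XX).snd
  map_add' _ _ := rfl
  map_smul' _ _ := rfl

/-- The matrix operator `𝔸 = (A_m 0; C B)` on `L²(0,1) × ℝ²`, that is
`𝔸 (u,v) = (A_m u, C u + B v)` for `(u,v) ∈ D(𝔸)`. -/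
def opA (b : Fin 2 → ℝ) : XX →ₗ.[ℝ] XX where
  domain := domA
  toFun := (WithLp.linearEquiv 2 ℝ (L2I × R2)).symm.toLinearMap ∘ₗ
    LinearMap.prod (Am ∘ₗ domA.fst) (C ∘ₗ domA.fst + B b ∘ₗ domA.snd)

theorem opA_apply (b : Fin 2 → ℝ) (w : domA) :
    opA b w = WithLp.toLp 2 (Am (domA.fst w), C (domA.fst w) + B b (domA.snd w)) := rfl

/-! ### The form -/

/-- The form domain `V = {(u,α) ∈ H¹(0,1) × ℝ² : u(0) = α₀, u(1) = α₁}`. -/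
def V : Submodule ℝ XX where
  carrier := {w | ∃ h : w.fst ∈ H1, L ⟨w.fst, h⟩ = w.snd}
  add_mem' := by
    rintro w z ⟨hw, hw'⟩ ⟨hz, hz'⟩
    refine ⟨H1.add_mem hw hz, ?_⟩
    rw [WithLp.add_snd, ← hw', ← hz', ← map_add]
    rfl
  zero_mem' := ⟨H1.zero_mem, map_zero L⟩
  smul_mem' := by
    rintro r w ⟨hw, hw'⟩
    refine ⟨H1.smul_mem r hw, ?_⟩
    rw [WithLp.smul_snd, ← hw', ← map_smul]
    rfl

/-- The first component of an element of `V`, as an element of `H¹(0,1)`. -/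
def V.fst : V →ₗ[ℝ] H1 where
  toFun w := ⟨(w : XX).fst, w.2.1⟩
  map_add' _ _ := rfl
  map_smul' _ _ := rfl

theorem integral_mul_eq_inner (u v : L2I) : ∫ x, u x * v x ∂μI = ⟪u, v⟫ := by
  rw [L2.inner_def]
  apply integral_congr_ae
  filter_upwards with x
  simp [mul_comm]

/-- The bilinear form
`a((u,α),(v,β)) = ∫₀¹ u' v' dx + b₀ u(0) v(0) + b₁ u(1) v(1)` on `V`. -/
def formA (b : Fin 2 → ℝ) : V →ₗ[ℝ] V →ₗ[ℝ] ℝ :=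
  LinearMap.mk₂ ℝ
    (fun w z => ∫ x, weakDeriv (V.fst w) x * weakDeriv (V.fst z) x ∂μI
      + b 0 * evalAt pt0 (V.fst w) * evalAt pt0 (V.fst z)
      + b 1 * evalAt pt1 (V.fst w) * evalAt pt1 (V.fst z))
    (fun w w' z => by simp only [integral_mul_eq_inner, map_add, inner_add_left]; ring)
    (fun r w z => by
      simp only [integral_mul_eq_inner, map_smul, real_inner_smul_left, smul_eq_mul]; ring)
    (fun w z z' => by simp only [integral_mul_eq_inner, map_add, inner_add_right]; ring)
    (fun r w z => by
      simp only [integral_mul_eq_inner, map_smul, real_inner_smul_right, smul_eq_mul]; ring)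

/-! ### Semigroups, generators, resolvents and forms on a real Hilbert space -/

section Abstract

variable {H : Type*} [NormedAddCommGroup H] [InnerProductSpace ℝ H]

/-- A strongly continuous semigroup `(T(t))_{t ≥ 0}` of bounded operators. -/
structure IsC0Semigroup (T : ℝ≥0 → H →L[ℝ] H) : Prop where
  map_zero : T 0 = ContinuousLinearMap.id ℝ H
  map_add : ∀ s t, T (s + t) = (T s).comp (T t)
  strongly_continuous : ∀ x, Continuous fun t => T t x

/-- `A` is the infinitesimal generator of `T`: the domain of `A` consists exactly of the `x` for
which `t⁻¹ (T(t) x - x)` has a limit as `t → 0+`, and `A x` is that limit. -/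
def IsGenerator (A : H →ₗ.[ℝ] H) (T : ℝ≥0 → H →L[ℝ] H) : Prop :=
  ∀ x y, (x, y) ∈ A.graph ↔
    Tendsto (fun t : ℝ≥0 => (t : ℝ)⁻¹ • (T t x - x)) (𝓝[>] 0) (𝓝 y)

/-- `R` is the resolvent `(l - A)⁻¹`, as an everywhere defined bounded operator. -/
def IsResolvent (A : H →ₗ.[ℝ] H) (l : ℝ) (R : H →L[ℝ] H) : Prop :=
  (∀ y, ∃ h : R y ∈ A.domain, l • R y - A ⟨R y, h⟩ = y) ∧
    ∀ x : A.domain, R (l • (x : H) - A x) = x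

/-- `A` has compact resolvent: its resolvent set is nonempty and all its resolvent operators are
compact. -/
def HasCompactResolvent (A : H →ₗ.[ℝ] H) : Prop :=
  (∃ l R, IsResolvent A l R) ∧ ∀ l R, IsResolvent A l R → IsCompactOperator R

/-- `A` is dissipative. -/
def IsDissipative (A : H →ₗ.[ℝ] H) : Prop := ∀ x : A.domain, ⟪A x, (x : H)⟫ ≤ 0

/-- The square `a(x,x) + ‖x‖²` of the form norm. -/
def formNormSq {D : Submodule ℝ H} (a : D →ₗ[ℝ] D →ₗ[ℝ] ℝ) (x : D) : ℝ :=
  a x x + ‖(x : H)‖ ^ 2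

/-- The (positive) form `a` is continuous with respect to its form norm. -/
def IsContinuousForm {D : Submodule ℝ H} (a : D →ₗ[ℝ] D →ₗ[ℝ] ℝ) : Prop :=
  ∃ M : ℝ, ∀ x y, |a x y| ≤ M * √(formNormSq a x) * √(formNormSq a y)

/-- The (positive, symmetric) form `a` is closed: its domain is complete for the form norm. -/
def IsClosedForm {D : Submodule ℝ H} (a : D →ₗ[ℝ] D →ₗ[ℝ] ℝ) : Prop :=
  ∀ x : ℕ → D, (∀ ε > 0, ∃ N, ∀ m ≥ N, ∀ n ≥ N, formNormSq a (x m - x n) < ε) →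
    ∃ y, Tendsto (fun n => formNormSq a (x n - y)) atTop (𝓝 0)

/-- `A` is the operator associated with the form `a`, with the sign convention
`a(f,h) = -⟪A f, h⟫`: the domain of `A` consists of those `f` in the form domain for which some `g`
satisfies `a(f,h) = ⟪g,h⟫` for all `h` in the form domain, and then `A f = -g`. -/
def IsAssociatedWith (A : H →ₗ.[ℝ] H) {D : Submodule ℝ H} (a : D →ₗ[ℝ] D →ₗ[ℝ] ℝ) : Prop :=
  ∀ f g : H, (f, -g) ∈ A.graph ↔ ∃ hf : f ∈ D, ∀ h : D, a ⟨f, hf⟩ h = ⟪g, (h : H)⟫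

end Abstract

set_option linter.unusedSectionVars false

/-! ### Complexification and analytic semigroups -/

/-- The complexification `H_ℂ` of a real Hilbert space `H`: the pair `(x,y)` stands for `x + i y`,
and `‖x + i y‖² = ‖x‖² + ‖y‖²`. -/
def Cplx (H : Type*) : Type _ := WithLp 2 (H × H)

namespace Cplx

variable {H : Type*} [NormedAddCommGroup H] [InnerProductSpace ℝ H]

instance : NormedAddCommGroup (Cplx H) := inferInstanceAs (NormedAddCommGroup (WithLp 2 (H × H)))

/-- The element `x + i y`. -/
def mk (x y : H) : Cplx H := WithLp.toLp 2 (x, y)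

/-- The real part. -/
def re (z : Cplx H) : H := WithLp.fst (p := 2) z

/-- The imaginary part. -/
def im (z : Cplx H) : H := WithLp.snd (p := 2) z

@[ext] theorem ext {z w : Cplx H} (h1 : re z = re w) (h2 : im z = im w) : z = w :=
  WithLp.ofLp_injective 2 (Prod.ext h1 h2)

@[simp] theorem re_mk (x y : H) : re (mk x y) = x := rfl
@[simp] theorem im_mk (x y : H) : im (mk x y) = y := rfl
@[simp] theorem re_add (z w : Cplx H) : re (z + w) = re z + re w := rfl
@[simp] theorem im_add (z w : Cplx H) : im (z + w) = im z + im w := rfl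
@[simp] theorem re_zero : re (0 : Cplx H) = 0 := rfl
@[simp] theorem im_zero : im (0 : Cplx H) = 0 := rfl

theorem norm_sq (z : Cplx H) : ‖z‖ ^ 2 = ‖re z‖ ^ 2 + ‖im z‖ ^ 2 :=
  WithLp.prod_norm_sq_eq_of_L2 (α := H) (β := H) z

instance : SMul ℂ (Cplx H) :=
  ⟨fun c z => mk (c.re • re z - c.im • im z) (c.re • im z + c.im • re z)⟩

@[simp] theorem re_smul (c : ℂ) (z : Cplx H) : re (c • z) = c.re • re z - c.im • im z := rfl
@[simp] theorem im_smul (c : ℂ) (z : Cplx H) : im (c • z) = c.re • im z + c.im • re z := rfl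

instance : Module ℂ (Cplx H) where
  one_smul z := by ext <;> simp
  mul_smul c d z := by
    ext <;> simp only [re_smul, im_smul, Complex.mul_re, Complex.mul_im] <;> module
  smul_zero c := by ext <;> simp
  smul_add c z w := by
    ext <;> simp only [re_smul, im_smul, re_add, im_add] <;> module
  add_smul c d z := by
    ext <;> simp only [re_smul, im_smul, re_add, im_add, Complex.add_re, Complex.add_im] <;> module
  zero_smul z := by ext <;> simp

theorem norm_smul_eq (c : ℂ) (z : Cplx H) : ‖c • z‖ = ‖c‖ * ‖z‖ := by
  rw [← sq_eq_sq₀ (norm_nonneg _) (by positivity), mul_pow, norm_sq, norm_sq, re_smul, im_smul,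
    norm_sub_sq_real, norm_add_sq_real, Complex.sq_norm, Complex.normSq_apply]
  simp only [norm_smul, real_inner_smul_left, real_inner_smul_right, mul_pow, Real.norm_eq_abs,
    sq_abs, real_inner_comm (im z) (re z)]
  ring

instance : NormedSpace ℂ (Cplx H) where
  norm_smul_le c z := (norm_smul_eq c z).le

/-- The complexification `T_ℂ (x + i y) = T x + i T y` of a bounded operator. -/
def map (T : H →L[ℝ] H) : Cplx H →L[ℂ] Cplx H :=
  LinearMap.mkContinuous
    { toFun := fun z => mk (T (re z)) (T (im z))
      map_add' := fun z w => by ext <;> simp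
      map_smul' := fun c z => by ext <;> simp }
    ‖T‖ (fun z => by
      rw [← sq_le_sq₀ (norm_nonneg _) (by positivity), mul_pow, norm_sq, norm_sq, mul_add,
        ← mul_pow, ← mul_pow]
      exact add_le_add (pow_le_pow_left₀ (norm_nonneg _) (T.le_opNorm _) 2)
        (pow_le_pow_left₀ (norm_nonneg _) (T.le_opNorm _) 2))

end Cplx

/-- The open sector `{z ≠ 0 : |arg z| < θ}`. -/
def sector (θ : ℝ) : Set ℂ := {z | z ≠ 0 ∧ |z.arg| < θ}

/-- The semigroup `T` on the real Hilbert space `H` is analytic of angle `θ`: its complexification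
extends to a family `S(z)`, `z ∈ sector θ ∪ {0}`, of bounded complex-linear operators on `H_ℂ` which
has the semigroup property, is holomorphic in the sector, and is strongly continuous at `0` in every
strictly smaller sector. -/
def IsAnalyticSemigroup {H : Type*} [NormedAddCommGroup H] [InnerProductSpace ℝ H]
    (θ : ℝ) (T : ℝ≥0 → H →L[ℝ] H) : Prop :=
  ∃ S : ℂ → (Cplx H →L[ℂ] Cplx H),
    (∀ t : ℝ≥0, S ((t : ℝ) : ℂ) = Cplx.map (T t)) ∧
    (∀ z ∈ sector θ, ∀ w ∈ sector θ, S (z + w) = (S z).comp (S w)) ∧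
    DifferentiableOn ℂ S (sector θ) ∧
    ∀ θ', 0 < θ' → θ' < θ → ∀ x, Tendsto (fun z => S z x) (𝓝[sector θ'] 0) (𝓝 x)

end DynBdry

end

/-! The proof inverts `-𝔸`, diagonalises the inverse, and defines the semigroup by its eigenvalues;
no generation theorem is used.

Green's formula (`formA_eq_neg_inner`) gives `a(w,h) = -⟪𝔸 w, h⟫` for `w ∈ D(𝔸)`, `h ∈ V`: the
boundary terms produced by integrating `u'' v` by parts are exactly those supplied by `C`, and `B`
contributes the terms with `b₀, b₁`. Hence `𝔸` is symmetric and dissipative. Since `u(x) = u(0) +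
∫₀ˣ u'`, the norm of `X` is controlled by `|u(0)|` and `‖u'‖`, so `a` is coercive (`formA_coercive`)
and `𝔸` is injective. Two integrations, with constants chosen through a solvable linear system, show
that `𝔸` is onto (`opA_surjective`). Symmetry and surjectivity alone yield density of the domain and
self-adjointness; Green's formula, surjectivity and coercivity show that `𝔸` is the operator
associated with `a`.

So `R = (-𝔸)⁻¹` is bounded, symmetric and positive definite, and it maps bounded sets to sets
bounded in `H¹`, whose elements are uniformly Hölder continuous; Arzelà–Ascoli makes `R` compact
(`exists_inverse`).

The spectral theorem provides a Hilbert basis with `R eₖ = μₖ eₖ`, `μₖ > 0`. With `λₖ = 1/μₖ`, put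
`T(t) eₖ = exp(-t λₖ) eₖ`. Contractivity, self-adjointness, analyticity, compactness and the
identification of the generator become estimates on scalar symbols (`exists_semigroup_of_compact`).
-/

noncomputable section

namespace DynBdry

/-! ### Operators diagonal in a Hilbert basis -/

section Diagonal

open scoped ENNReal lp

variable {ι H : Type*} [NormedAddCommGroup H] [InnerProductSpace ℝ H]

theorem HilbertBasis.ext_inner (e : HilbertBasis ι ℝ H) {x y : H}
    (h : ∀ i, ⟪e i, x⟫ = ⟪e i, y⟫) : x = y := by
  apply e.repr.injective
  ext i
  rw [e.repr_apply_apply, e.repr_apply_apply, h]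

theorem HilbertBasis.hasSum_inner_sq (e : HilbertBasis ι ℝ H) (x : H) :
    HasSum (fun i => ⟪e i, x⟫ ^ 2) (‖x‖ ^ 2) := by
  have := e.hasSum_inner_mul_inner x x
  rw [real_inner_self_eq_norm_sq] at this
  convert! this using 2 with i
  rw [real_inner_comm, sq]

/-- The operator that is diagonal in the Hilbert basis `e`, with the bounded symbol `m`. -/
def diagOp (e : HilbertBasis ι ℝ H) : lp (fun _ : ι => ℝ) ∞ →ₗ[ℝ] H →L[ℝ] H where
  toFun m := (e.repr.symm.toContinuousLinearEquiv : ℓ²(ι, ℝ) →L[ℝ] H) ∘L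
    (lp.holderL 2 (fun _ : ι => ContinuousLinearMap.mul ℝ ℝ) (K := 1)
      (fun _ => by simp) m) ∘L (e.repr.toContinuousLinearEquiv : H →L[ℝ] ℓ²(ι, ℝ))
  map_add' m n := by ext x; simp
  map_smul' r m := by ext x; simp

/-- Combined with `HilbertBasis.ext_inner`, this reduces operator identities to identities between
numbers, one coordinate at a time. -/
theorem inner_diagOp (e : HilbertBasis ι ℝ H) (m : lp (fun _ : ι => ℝ) ∞) (x : H) (i : ι) :
    ⟪e i, diagOp e m x⟫ = m i * ⟪e i, x⟫ := by
  rw [← e.repr_apply_apply, ← e.repr_apply_apply]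
  simp [diagOp, lp.holderL]

theorem norm_diagOp_le (e : HilbertBasis ι ℝ H) (m : lp (fun _ : ι => ℝ) ∞) :
    ‖diagOp e m‖ ≤ ‖m‖ := by
  refine ContinuousLinearMap.opNorm_le_bound _ (norm_nonneg _) fun x => ?_
  simp only [diagOp, LinearMap.coe_mk, AddHom.coe_mk, ContinuousLinearMap.comp_apply,
    ContinuousLinearEquiv.coe_coe, LinearIsometryEquiv.coe_toContinuousLinearEquiv,
    LinearIsometryEquiv.norm_map]
  refine (ContinuousLinearMap.le_opNorm₂ _ _ _).trans ?_
  rw [LinearIsometryEquiv.norm_map]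
  have := lp.norm_holderL_le (p := ∞) (q := 2) 2 (fun _ : ι => ContinuousLinearMap.mul ℝ ℝ)
    (K := 1) (fun _ => by simp)
  calc _ ≤ 1 * ‖m‖ * ‖x‖ := by gcongr; exact this
    _ = _ := by ring

theorem diagOp_mul (e : HilbertBasis ι ℝ H) (m n : lp (fun _ : ι => ℝ) ∞) :
    diagOp e (m * n) = (diagOp e m).comp (diagOp e n) := by
  ext x
  refine HilbertBasis.ext_inner e fun i => ?_
  simp [inner_diagOp, mul_assoc]

theorem diagOp_one (e : HilbertBasis ι ℝ H) : diagOp e 1 = ContinuousLinearMap.id ℝ H := by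
  ext x
  refine HilbertBasis.ext_inner e fun i => ?_
  simp [inner_diagOp]

theorem inner_diagOp_comm (e : HilbertBasis ι ℝ H) (m : lp (fun _ : ι => ℝ) ∞) (x y : H) :
    ⟪diagOp e m x, y⟫ = ⟪x, diagOp e m y⟫ := by
  rw [← e.tsum_inner_mul_inner, ← e.tsum_inner_mul_inner]
  congr 1 with i
  rw [real_inner_comm, inner_diagOp, inner_diagOp, real_inner_comm]
  ring

/-- Bounded pointwise convergence of the symbols gives strong convergence of the operators. -/
theorem tendsto_diagOp {α : Type*} {l : Filter α} (e : HilbertBasis ι ℝ H)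
    {m : α → lp (fun _ : ι => ℝ) ∞} {m₀ : lp (fun _ : ι => ℝ) ∞} {K : ℝ}
    (hK : ∀ᶠ a in l, ∀ i, |m a i| ≤ K) (h : ∀ i, Tendsto (fun a => m a i) l (𝓝 (m₀ i))) (x : H) :
    Tendsto (fun a => diagOp e (m a) x) l (𝓝 (diagOp e m₀ x)) := by
  rw [tendsto_iff_norm_sub_tendsto_zero]
  have key : Tendsto (fun a => ‖diagOp e (m a) x - diagOp e m₀ x‖ ^ 2) l (𝓝 0) := by
    have e1 : ∀ a, ‖diagOp e (m a) x - diagOp e m₀ x‖ ^ 2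
        = ∑' i, (m a i - m₀ i) ^ 2 * ⟪e i, x⟫ ^ 2 := fun a => by
      rw [← (HilbertBasis.hasSum_inner_sq e _).tsum_eq]
      congr 1 with i
      rw [inner_sub_right, inner_diagOp, inner_diagOp]
      ring
    -- By Parseval the squared error is a series with terms tending to zero, dominated by a multiple
    -- of `⟪e i, x⟫ ^ 2`.
    simp only [e1]
    have e2 : (0 : ℝ) = ∑' i : ι, (m₀ i - m₀ i) ^ 2 * ⟪e i, x⟫ ^ 2 := by simp
    rw [e2]
    refine tendsto_tsum_of_dominated_convergence
      (bound := fun i => (K + ‖m₀‖) ^ 2 * ⟪e i, x⟫ ^ 2)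
      ((HilbertBasis.hasSum_inner_sq e x).summable.mul_left _) (fun i => ?_) ?_
    · exact (((h i).sub_const _).pow 2).mul_const _
    · filter_upwards [hK] with a ha i
      rw [Real.norm_eq_abs, abs_of_nonneg (by positivity)]
      gcongr ?_ * _
      rw [← sq_abs]
      gcongr
      calc |m a i - m₀ i| ≤ |m a i| + |m₀ i| := abs_sub _ _
        _ ≤ K + ‖m₀‖ := add_le_add (ha i) (lp.norm_apply_le_norm (by simp) m₀ i)
  have := (Real.continuous_sqrt.tendsto 0).comp key
  simpa [Function.comp_def, Real.sqrt_sq (norm_nonneg _)] using this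

/-- The real part of a bounded complex symbol. -/
def symbolRe (m : lp (fun _ : ι => ℂ) ∞) : lp (fun _ : ι => ℝ) ∞ :=
  ⟨fun i => (m i).re, memℓp_infty ⟨‖m‖, by
    rintro _ ⟨i, rfl⟩
    exact (Complex.abs_re_le_norm _).trans (lp.norm_apply_le_norm (by simp) m i)⟩⟩

/-- The imaginary part of a bounded complex symbol. -/
def symbolIm (m : lp (fun _ : ι => ℂ) ∞) : lp (fun _ : ι => ℝ) ∞ :=
  ⟨fun i => (m i).im, memℓp_infty ⟨‖m‖, by
    rintro _ ⟨i, rfl⟩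
    exact (Complex.abs_im_le_norm _).trans (lp.norm_apply_le_norm (by simp) m i)⟩⟩

@[simp] theorem symbolRe_apply (m : lp (fun _ : ι => ℂ) ∞) (i : ι) :
    symbolRe m i = (m i).re := rfl

@[simp] theorem symbolIm_apply (m : lp (fun _ : ι => ℂ) ∞) (i : ι) :
    symbolIm m i = (m i).im := rfl

theorem norm_symbolRe_le (m : lp (fun _ : ι => ℂ) ∞) : ‖symbolRe m‖ ≤ ‖m‖ :=
  lp.norm_le_of_forall_le (norm_nonneg _) fun i =>
    (Complex.abs_re_le_norm _).trans (lp.norm_apply_le_norm (by simp) m i)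

theorem norm_symbolIm_le (m : lp (fun _ : ι => ℂ) ∞) : ‖symbolIm m‖ ≤ ‖m‖ :=
  lp.norm_le_of_forall_le (norm_nonneg _) fun i =>
    (Complex.abs_im_le_norm _).trans (lp.norm_apply_le_norm (by simp) m i)

theorem Cplx.norm_mk_le (x y : H) : ‖Cplx.mk x y‖ ≤ ‖x‖ + ‖y‖ := by
  rw [← sq_le_sq₀ (norm_nonneg _) (by positivity), Cplx.norm_sq, Cplx.re_mk, Cplx.im_mk]
  nlinarith [norm_nonneg x, norm_nonneg y]

theorem Cplx.norm_re_le (z : Cplx H) : ‖Cplx.re z‖ ≤ ‖z‖ := by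
  rw [← sq_le_sq₀ (norm_nonneg _) (norm_nonneg _), Cplx.norm_sq]
  nlinarith [norm_nonneg (Cplx.im z)]

theorem Cplx.norm_im_le (z : Cplx H) : ‖Cplx.im z‖ ≤ ‖z‖ := by
  rw [← sq_le_sq₀ (norm_nonneg _) (norm_nonneg _), Cplx.norm_sq]
  nlinarith [norm_nonneg (Cplx.re z)]

theorem Cplx.tendsto_mk {α : Type*} {l : Filter α} {f g : α → H} {x y : H}
    (hf : Tendsto f l (𝓝 x)) (hg : Tendsto g l (𝓝 y)) :
    Tendsto (fun a => Cplx.mk (f a) (g a)) l (𝓝 (Cplx.mk x y)) := by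
  rw [tendsto_iff_norm_sub_tendsto_zero] at *
  refine squeeze_zero (fun _ => norm_nonneg _) (fun a => ?_) (by simpa using hf.add hg)
  exact Cplx.norm_mk_le (f a - x) (g a - y)

/-- The operator on the complexification that is diagonal in the Hilbert basis `e`, with a bounded
complex symbol. -/
def cdiagOp (e : HilbertBasis ι ℝ H) :
    lp (fun _ : ι => ℂ) ∞ →L[ℂ] Cplx H →L[ℂ] Cplx H :=
  LinearMap.mkContinuous₂
    (LinearMap.mk₂ ℂ (fun m z => Cplx.mk
        (diagOp e (symbolRe m) (Cplx.re z) - diagOp e (symbolIm m) (Cplx.im z))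
        (diagOp e (symbolRe m) (Cplx.im z) + diagOp e (symbolIm m) (Cplx.re z)))
      (fun m n z => by
        ext <;> refine HilbertBasis.ext_inner e fun i => ?_ <;>
          simp [inner_add_right, inner_sub_right, inner_diagOp] <;> ring)
      (fun c m z => by
        ext <;> refine HilbertBasis.ext_inner e fun i => ?_ <;>
          simp [inner_add_right, inner_sub_right, inner_diagOp, inner_smul_right] <;> ring)
      (fun m z w => by
        ext <;> refine HilbertBasis.ext_inner e fun i => ?_ <;>
          simp [inner_add_right, inner_sub_right, inner_diagOp] <;> ring)
      (fun c m z => by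
        ext <;> refine HilbertBasis.ext_inner e fun i => ?_ <;>
          simp [inner_add_right, inner_sub_right, inner_diagOp, inner_smul_right] <;> ring))
    4 (fun m z => by
      have b1 : ∀ x, ‖x‖ ≤ ‖z‖ → ‖diagOp e (symbolRe m) x‖ ≤ ‖m‖ * ‖z‖ := fun x hx =>
        (ContinuousLinearMap.le_opNorm _ _).trans
          (mul_le_mul ((norm_diagOp_le e _).trans (norm_symbolRe_le m)) hx (norm_nonneg _)
            (norm_nonneg _))
      have b2 : ∀ x, ‖x‖ ≤ ‖z‖ → ‖diagOp e (symbolIm m) x‖ ≤ ‖m‖ * ‖z‖ := fun x hx =>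
        (ContinuousLinearMap.le_opNorm _ _).trans
          (mul_le_mul ((norm_diagOp_le e _).trans (norm_symbolIm_le m)) hx (norm_nonneg _)
            (norm_nonneg _))
      rw [LinearMap.mk₂_apply]
      refine (Cplx.norm_mk_le _ _).trans ?_
      linarith [norm_sub_le (diagOp e (symbolRe m) (Cplx.re z))
          (diagOp e (symbolIm m) (Cplx.im z)),
        norm_add_le (diagOp e (symbolRe m) (Cplx.im z)) (diagOp e (symbolIm m) (Cplx.re z)),
        b1 _ (Cplx.norm_re_le z), b1 _ (Cplx.norm_im_le z), b2 _ (Cplx.norm_re_le z),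
        b2 _ (Cplx.norm_im_le z)])

theorem cdiagOp_apply (e : HilbertBasis ι ℝ H) (m : lp (fun _ : ι => ℂ) ∞) (z : Cplx H) :
    cdiagOp e m z = Cplx.mk
      (diagOp e (symbolRe m) (Cplx.re z) - diagOp e (symbolIm m) (Cplx.im z))
      (diagOp e (symbolRe m) (Cplx.im z) + diagOp e (symbolIm m) (Cplx.re z)) := rfl

theorem cdiagOp_mul (e : HilbertBasis ι ℝ H) (m n : lp (fun _ : ι => ℂ) ∞) :
    cdiagOp e (m * n) = (cdiagOp e m).comp (cdiagOp e n) := by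
  ext z <;> refine HilbertBasis.ext_inner e fun i => ?_ <;>
    simp [cdiagOp_apply, inner_add_right, inner_sub_right, inner_diagOp] <;> ring

theorem cdiagOp_of_real (e : HilbertBasis ι ℝ H) {m : lp (fun _ : ι => ℂ) ∞}
    {r : lp (fun _ : ι => ℝ) ∞} (h : ∀ i, m i = (r i : ℂ)) :
    cdiagOp e m = Cplx.map (diagOp e r) := by
  ext z <;> refine HilbertBasis.ext_inner e fun i => ?_ <;>
    simp [cdiagOp_apply, Cplx.map, inner_add_right, inner_sub_right, inner_diagOp, h]

/-- Serves for strong continuity at `0`, where `exp (-z lam)` tends to `1` for each eigenvalue but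
not uniformly when the eigenvalues are unbounded. -/
theorem tendsto_cdiagOp {α : Type*} {l : Filter α} (e : HilbertBasis ι ℝ H)
    {m : α → lp (fun _ : ι => ℂ) ∞} {m₀ : lp (fun _ : ι => ℂ) ∞} {K : ℝ}
    (hK : ∀ᶠ a in l, ∀ i, ‖m a i‖ ≤ K) (h : ∀ i, Tendsto (fun a => m a i) l (𝓝 (m₀ i)))
    (z : Cplx H) : Tendsto (fun a => cdiagOp e (m a) z) l (𝓝 (cdiagOp e m₀ z)) := by
  simp only [cdiagOp_apply]
  have h1 : ∀ x, Tendsto (fun a => diagOp e (symbolRe (m a)) x) l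
      (𝓝 (diagOp e (symbolRe m₀) x)) :=
    tendsto_diagOp e (hK.mono fun a ha i => (Complex.abs_re_le_norm _).trans (ha i))
      fun i => (Complex.continuous_re.tendsto _).comp (h i)
  have h2 : ∀ x, Tendsto (fun a => diagOp e (symbolIm (m a)) x) l
      (𝓝 (diagOp e (symbolIm m₀) x)) :=
    tendsto_diagOp e (hK.mono fun a ha i => (Complex.abs_im_le_norm _).trans (ha i))
      fun i => (Complex.continuous_im.tendsto _).comp (h i)
  exact Cplx.tendsto_mk ((h1 _).sub (h2 _)) ((h1 _).add (h2 _))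

end Diagonal
-- The semigroup generated by the negative of the inverse of a compact operator
section SemigroupOfCompact

universe u

open scoped ENNReal lp

variable {ι : Type*}

/-- The symbol `exp (-z lam)`, where it is bounded. -/
def expSymbol (lam : ι → ℝ) (z : ℂ) : lp (fun _ : ι => ℂ) ∞ :=
  -- The default value `0` only makes the symbol total in `z`; for nonnegative `lam` it does not
  -- occur when `0 ≤ z.re`.
  open scoped Classical in
  if h : Memℓp (fun i => Complex.exp (-(z * lam i))) ∞ then ⟨_, h⟩ else 0

theorem norm_exp_neg_mul_le_one {z : ℂ} (hz : 0 ≤ z.re) {l : ℝ} (hl : 0 ≤ l) :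
    ‖Complex.exp (-(z * l))‖ ≤ 1 := by
  rw [Complex.norm_exp, Real.exp_le_one_iff]
  simp only [Complex.neg_re, Complex.mul_re, Complex.ofReal_re, Complex.ofReal_im, mul_zero,
    sub_zero]
  nlinarith

theorem expSymbol_apply {lam : ι → ℝ} (hlam : ∀ i, 0 ≤ lam i) {z : ℂ} (hz : 0 ≤ z.re) (i : ι) :
    expSymbol lam z i = Complex.exp (-(z * lam i)) := by
  have h : Memℓp (fun i => Complex.exp (-(z * lam i))) ∞ := memℓp_infty ⟨1, by
    rintro _ ⟨i, rfl⟩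
    exact norm_exp_neg_mul_le_one hz (hlam i)⟩
  rw [expSymbol, dif_pos h]

theorem sq_mul_exp_neg_le {r l : ℝ} (hr : 0 < r) (hl : 0 ≤ l) :
    l ^ 2 * Real.exp (-(r * l)) ≤ 2 / r ^ 2 := by
  have h := Real.quadratic_le_exp_of_nonneg (mul_nonneg hr.le hl)
  rw [Real.exp_neg, ← div_eq_mul_inv, div_le_div_iff₀ (Real.exp_pos _) (by positivity)]
  nlinarith [mul_nonneg hr.le hl]

theorem mul_exp_neg_le {r l : ℝ} (hr : 0 < r) :
    l * Real.exp (-(r * l)) ≤ 1 / r := by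
  have h := Real.add_one_le_exp (r * l)
  rw [Real.exp_neg, ← div_eq_mul_inv, div_le_div_iff₀ (Real.exp_pos _) (by positivity)]
  nlinarith

theorem norm_exp_neg_mul {z : ℂ} {l : ℝ} :
    ‖Complex.exp (-(z * l))‖ = Real.exp (-(z.re * l)) := by
  rw [Complex.norm_exp]; simp

/-- The bound must not depend on `l`. Factor out `exp (-z l)` and bound the second-order remainder
by `(‖h‖ l)² exp (‖h‖ l)`. Half of the decay rate `z.re` absorbs the exponential, the other half
absorbs `l²`, which gives the constant `2 / (z.re / 2)² = 8 / z.re²`. -/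
theorem norm_exp_taylor_le {z h : ℂ} {l : ℝ} (hz : 0 < z.re) (hl : 0 ≤ l)
    (hh : ‖h‖ ≤ z.re / 2) :
    ‖Complex.exp (-((z + h) * l)) - Complex.exp (-(z * l)) - h * (-l * Complex.exp (-(z * l)))‖
      ≤ 8 / z.re ^ 2 * ‖h‖ ^ 2 := by
  have e1 : Complex.exp (-((z + h) * l)) - Complex.exp (-(z * l))
      - h * (-l * Complex.exp (-(z * l)))
      = Complex.exp (-(z * l)) * (Complex.exp (-(h * l)) -
          ∑ m ∈ Finset.range 2, (-(h * l)) ^ m / (m.factorial : ℂ)) := by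
    rw [show -((z + h) * l) = -(z * l) + -(h * l) by ring, Complex.exp_add]
    simp [Finset.sum_range_succ]
    ring
  rw [e1, norm_mul, norm_exp_neg_mul]
  have e2 := Complex.norm_exp_sub_sum_le_norm_mul_exp (-(h * l)) 2
  have e3 : ‖-(h * (l : ℂ))‖ = ‖h‖ * l := by
    rw [norm_neg, norm_mul, Complex.norm_real, Real.norm_eq_abs, abs_of_nonneg hl]
  rw [e3] at e2
  calc _ ≤ Real.exp (-(z.re * l)) * ((‖h‖ * l) ^ 2 * Real.exp (‖h‖ * l)) := by gcongr
    _ ≤ Real.exp (-(z.re * l)) * ((‖h‖ * l) ^ 2 * Real.exp (z.re / 2 * l)) := by gcongr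
    _ = ‖h‖ ^ 2 * (l ^ 2 * Real.exp (-(z.re / 2 * l))) := by
      rw [show -(z.re / 2 * l) = -(z.re * l) + z.re / 2 * l by ring, Real.exp_add]
      ring
    _ ≤ ‖h‖ ^ 2 * (2 / (z.re / 2) ^ 2) := by
      gcongr
      exact sq_mul_exp_neg_le (by positivity) hl
    _ = _ := by field_simp; ring

/-- The Taylor remainder is quadratic in `h` uniformly over the index, so the coordinatewise
derivative is a derivative in the supremum norm. Composing with the bounded linear map `cdiagOp e`
then gives holomorphy in operator norm. -/
theorem differentiableAt_expSymbol {lam : ι → ℝ} (hlam : ∀ i, 0 ≤ lam i) {z : ℂ}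
    (hz : 0 < z.re) : DifferentiableAt ℂ (expSymbol lam) z := by
  have hd : Memℓp (fun i => -lam i * Complex.exp (-(z * lam i))) ∞ := memℓp_infty ⟨1 / z.re, by
    rintro _ ⟨i, rfl⟩
    simp only [norm_mul, norm_neg, norm_exp_neg_mul, Complex.norm_real, Real.norm_eq_abs,
      abs_of_nonneg (hlam i)]
    exact mul_exp_neg_le hz⟩
  have : HasDerivAt (expSymbol lam) (⟨_, hd⟩ : lp (fun _ : ι => ℂ) ∞) z := by
    rw [hasDerivAt_iff_isLittleO_nhds_zero]
    refine Asymptotics.IsBigO.trans_isLittleO (g := fun h : ℂ => h ^ 2) ?_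
      (Asymptotics.isLittleO_pow_id one_lt_two)
    refine Asymptotics.IsBigO.of_bound (8 / z.re ^ 2) ?_
    filter_upwards [Metric.closedBall_mem_nhds (0 : ℂ) (half_pos hz)] with h hh
    rw [mem_closedBall_zero_iff] at hh
    have hzh : 0 ≤ (z + h).re := by
      have := (abs_le.1 (Complex.abs_re_le_norm h)).1
      rw [Complex.add_re]
      linarith
    refine lp.norm_le_of_forall_le (by positivity) fun i => ?_
    rw [norm_pow]
    have := norm_exp_taylor_le hz (hlam i) hh
    change ‖expSymbol lam (z + h) i - expSymbol lam z i - h * _‖ ≤ _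
    rwa [expSymbol_apply hlam hzh, expSymbol_apply hlam hz.le]
  exact this.differentiableAt

variable {H : Type*} [NormedAddCommGroup H] [InnerProductSpace ℝ H]

/-- The real symbol `exp (-t lam)`. -/
def realExpSymbol {lam : ι → ℝ} (hlam : ∀ i, 0 ≤ lam i) (t : ℝ≥0) : lp (fun _ : ι => ℝ) ∞ :=
  ⟨fun i => Real.exp (-(t * lam i)), memℓp_infty ⟨1, by
    rintro _ ⟨i, rfl⟩
    have := mul_nonneg t.2 (hlam i)
    simpa using this⟩⟩

theorem realExpSymbol_apply {lam : ι → ℝ} (hlam : ∀ i, 0 ≤ lam i) (t : ℝ≥0) (i : ι) :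
    realExpSymbol hlam t i = Real.exp (-(t * lam i)) := rfl

theorem abs_realExpSymbol_le {lam : ι → ℝ} (hlam : ∀ i, 0 ≤ lam i) (t : ℝ≥0) (i : ι) :
    |realExpSymbol hlam t i| ≤ 1 := by
  have := mul_nonneg t.2 (hlam i)
  rw [realExpSymbol_apply, Real.abs_exp, Real.exp_le_one_iff]
  simpa using this

theorem realExpSymbol_add {lam : ι → ℝ} (hlam : ∀ i, 0 ≤ lam i) (s t : ℝ≥0) :
    realExpSymbol hlam (s + t) = realExpSymbol hlam s * realExpSymbol hlam t := by
  ext i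
  simp only [lp.infty_coeFn_mul, Pi.mul_apply, realExpSymbol_apply, ← Real.exp_add]
  congr 1
  push_cast
  ring

theorem realExpSymbol_zero {lam : ι → ℝ} (hlam : ∀ i, 0 ≤ lam i) :
    realExpSymbol hlam 0 = 1 := by
  ext i
  simp [realExpSymbol_apply]

/-- The semigroup that is diagonal in the Hilbert basis `e`, with symbol `exp (-t lam)`. -/
def diagSemigroup (e : HilbertBasis ι ℝ H) {lam : ι → ℝ} (hlam : ∀ i, 0 ≤ lam i) (t : ℝ≥0) :
    H →L[ℝ] H := diagOp e (realExpSymbol hlam t)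

theorem inner_diagSemigroup (e : HilbertBasis ι ℝ H) {lam : ι → ℝ} (hlam : ∀ i, 0 ≤ lam i)
    (t : ℝ≥0) (x : H) (i : ι) :
    ⟪e i, diagSemigroup e hlam t x⟫ = Real.exp (-(t * lam i)) * ⟪e i, x⟫ :=
  inner_diagOp e _ x i

theorem isC0Semigroup_diagSemigroup (e : HilbertBasis ι ℝ H) {lam : ι → ℝ}
    (hlam : ∀ i, 0 ≤ lam i) : IsC0Semigroup (diagSemigroup e hlam) where
  map_zero := by rw [diagSemigroup, realExpSymbol_zero, diagOp_one]
  map_add s t := by simp only [diagSemigroup, realExpSymbol_add, diagOp_mul]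
  strongly_continuous x := continuous_iff_continuousAt.2 fun t =>
    tendsto_diagOp e (Eventually.of_forall fun s => abs_realExpSymbol_le hlam s)
      (fun i => by
        simp only [realExpSymbol_apply]
        exact Continuous.tendsto (by fun_prop) t) x

theorem norm_diagSemigroup_le (e : HilbertBasis ι ℝ H) {lam : ι → ℝ}
    (hlam : ∀ i, 0 ≤ lam i) (t : ℝ≥0) : ‖diagSemigroup e hlam t‖ ≤ 1 :=
  (norm_diagOp_le e _).trans
    (lp.norm_le_of_forall_le zero_le_one fun i => abs_realExpSymbol_le hlam t i)

theorem re_pos_of_mem_sector {z : ℂ} (hz : z ∈ sector (Real.pi / 2)) : 0 < z.re :=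
  (Complex.abs_arg_lt_pi_div_two_iff.1 hz.2).resolve_right hz.1

theorem isAnalyticSemigroup_diagSemigroup (e : HilbertBasis ι ℝ H) {lam : ι → ℝ}
    (hlam : ∀ i, 0 ≤ lam i) : IsAnalyticSemigroup (Real.pi / 2) (diagSemigroup e hlam) := by
  refine ⟨fun z => cdiagOp e (expSymbol lam z), fun t => ?_, fun z hz w hw => ?_, ?_,
    fun θ _ hθ x => ?_⟩
  · refine cdiagOp_of_real e fun i => ?_
    rw [expSymbol_apply hlam (by simp), realExpSymbol_apply]
    push_cast
    rfl
  · have hz := re_pos_of_mem_sector hz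
    have hw := re_pos_of_mem_sector hw
    suffices key : expSymbol lam (z + w) = expSymbol lam z * expSymbol lam w from
      (congrArg (cdiagOp e) key).trans (cdiagOp_mul e _ _)
    ext i
    rw [lp.infty_coeFn_mul, Pi.mul_apply, expSymbol_apply hlam hz.le, expSymbol_apply hlam hw.le,
      expSymbol_apply hlam (by rw [Complex.add_re]; positivity), ← Complex.exp_add]
    congr 1
    ring
  · intro z hz
    exact ((cdiagOp e).differentiableAt.comp z
      (differentiableAt_expSymbol hlam (re_pos_of_mem_sector hz))).differentiableWithinAt
  · have hre : ∀ᶠ z in 𝓝[sector θ] (0 : ℂ), 0 ≤ z.re := by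
      filter_upwards [self_mem_nhdsWithin] with z hz
      exact (re_pos_of_mem_sector ⟨hz.1, hz.2.trans hθ⟩).le
    have h1 : cdiagOp e (1 : lp (fun _ : ι => ℂ) ∞) x = x := by
      rw [cdiagOp_of_real (r := 1) e (by simp), diagOp_one]
      rfl
    -- The limit `x` is rewritten as the diagonal operator with symbol `1` applied to `x`, so that
    -- bounded pointwise convergence of symbols suffices.
    nth_rw 2 [← h1]
    refine tendsto_cdiagOp (K := 1) e ?_ (fun i => ?_) x
    · filter_upwards [hre] with z hz i
      rw [expSymbol_apply hlam hz]
      exact norm_exp_neg_mul_le_one hz (hlam i)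
    · have : Tendsto (fun z : ℂ => Complex.exp (-(z * lam i))) (𝓝[sector θ] 0) (𝓝 1) := by
        have : Continuous fun z : ℂ => Complex.exp (-(z * lam i)) := by fun_prop
        simpa using (this.tendsto 0).mono_left nhdsWithin_le_nhds
      refine this.congr' ?_
      filter_upwards [hre] with z hz
      rw [expSymbol_apply hlam hz]

theorem isSelfAdjoint_diagSemigroup [CompleteSpace H] (e : HilbertBasis ι ℝ H) {lam : ι → ℝ}
    (hlam : ∀ i, 0 ≤ lam i) (t : ℝ≥0) : IsSelfAdjoint (diagSemigroup e hlam t) := by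
  rw [ContinuousLinearMap.isSelfAdjoint_iff_isSymmetric]
  exact inner_diagOp_comm e _

/-- The semigroup is compact if the inverse of its generator is. -/
theorem isCompactOperator_diagSemigroup (e : HilbertBasis ι ℝ H) {lam : ι → ℝ}
    (hlam : ∀ i, 0 < lam i) {R : H →L[ℝ] H} (hR : IsCompactOperator R)
    (hRe : ∀ x i, ⟪e i, R x⟫ = (lam i)⁻¹ * ⟪e i, x⟫) {t : ℝ≥0} (ht : 0 < t) :
    IsCompactOperator (diagSemigroup e (fun i => (hlam i).le) t) := by
  have ht' : 0 < (t : ℝ) := ht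
  have hm : Memℓp (fun i => lam i * Real.exp (-(t * lam i))) ∞ := memℓp_infty ⟨1 / t, by
    rintro _ ⟨i, rfl⟩
    simp only [Real.norm_eq_abs, abs_mul, abs_of_pos (hlam i), Real.abs_exp]
    exact mul_exp_neg_le ht'⟩
  -- The factorisation `exp (-t lam) = lam⁻¹ * (lam * exp (-t lam))`: the second factor is bounded
  -- by `1 / t` and the first is the symbol of the compact `R`.
  have : diagSemigroup e (fun i => (hlam i).le) t
      = R.comp (diagOp e (⟨_, hm⟩ : lp (fun _ : ι => ℝ) ∞)) := by
    ext x
    refine HilbertBasis.ext_inner e fun i => ?_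
    rw [inner_diagSemigroup, ContinuousLinearMap.comp_apply, hRe, inner_diagOp]
    field_simp [(hlam i).ne']
  rw [this]
  exact hR.comp_clm _

theorem tendsto_slope_exp_neg (l : ℝ) :
    Tendsto (fun t : ℝ≥0 => (t : ℝ)⁻¹ * (Real.exp (-(t * l)) - 1)) (𝓝[>] 0) (𝓝 (-l)) := by
  have h : HasDerivAt (fun t : ℝ => Real.exp (-(t * l))) (-l) 0 := by
    have h1 : HasDerivAt (fun t : ℝ => -(t * l)) (-l) 0 := by
      exact (hasDerivAt_mul_const l).fun_neg
    simpa using h1.exp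
  have h2 := hasDerivAt_iff_tendsto_slope_zero.1 h
  have h3 : Tendsto (fun t : ℝ≥0 => (t : ℝ)) (𝓝[>] 0) (𝓝[≠] 0) := by
    refine tendsto_nhdsWithin_iff.2 ⟨?_, ?_⟩
    · exact (NNReal.continuous_coe.tendsto 0).mono_left nhdsWithin_le_nhds
    · filter_upwards [self_mem_nhdsWithin] with t ht
      exact ne_of_gt (NNReal.coe_pos.2 ht)
  simpa [Function.comp_def] using h2.comp h3

/-- If `x = -R y`, the difference quotient at `x` is the diagonal operator with symbol `(1 - exp (-t
lam)) / (t lam)` applied to `y`; this symbol lies in `[0,1]` and tends to `1`. Conversely, pairing a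
limit `y` of the quotients with `e i` forces `⟪e i, y⟫ = -lam i * ⟪e i, x⟫`, which is `x = -R y`. -/
theorem isGenerator_diagSemigroup (e : HilbertBasis ι ℝ H) {lam : ι → ℝ}
    (hlam : ∀ i, 0 < lam i) {R : H →L[ℝ] H}
    (hRe : ∀ x i, ⟪e i, R x⟫ = (lam i)⁻¹ * ⟪e i, x⟫) {A : H →ₗ.[ℝ] H}
    (hA : ∀ x y, (x, y) ∈ A.graph ↔ x = -R y) :
    IsGenerator A (diagSemigroup e (fun i => (hlam i).le)) := by
  intro x y
  rw [hA]
  constructor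
  · rintro rfl
    have hb : ∀ t : ℝ≥0, ∀ i,
        |(t : ℝ)⁻¹ * (1 - Real.exp (-(t * lam i))) * (lam i)⁻¹| ≤ 1 := fun t i => by
      have h1 := Real.add_one_le_exp (-(t * lam i))
      have h2 : Real.exp (-(t * lam i)) ≤ 1 := by
        rw [Real.exp_le_one_iff]
        have := mul_nonneg t.2 (hlam i).le
        simpa using this
      rcases eq_or_lt_of_le t.2 with h0 | h0
      · rw [show (t : ℝ) = 0 from h0.symm]; simp
      · have hl := hlam i
        change 0 < (t : ℝ) at h0
        rw [abs_of_nonneg (by have := sub_nonneg.2 h2; positivity), ← div_eq_mul_inv,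
          div_le_one hl, inv_mul_le_iff₀ h0]
        linarith
    let m : ℝ≥0 → lp (fun _ : ι => ℝ) ∞ := fun t => ⟨_, memℓp_infty ⟨1, by
      rintro _ ⟨i, rfl⟩
      exact hb t i⟩⟩
    have h := tendsto_diagOp (l := 𝓝[>] (0 : ℝ≥0)) (m := m) (m₀ := 1) (K := 1) e
      (Eventually.of_forall fun t i => hb t i) (fun i => by
        have h1 := ((tendsto_slope_exp_neg (lam i)).neg).mul_const (lam i)⁻¹
        rw [neg_neg, mul_inv_cancel₀ (hlam i).ne'] at h1
        simp only [lp.infty_coeFn_one, Pi.one_apply]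
        refine h1.congr fun t => ?_
        simp only [m]
        ring) y
    rw [diagOp_one, ContinuousLinearMap.id_apply] at h
    refine h.congr fun t => HilbertBasis.ext_inner e fun i => ?_
    rw [inner_diagOp, inner_smul_right, inner_sub_right, inner_diagSemigroup, inner_neg_right, hRe]
    simp only [m]
    ring
  · intro h
    refine HilbertBasis.ext_inner e fun i => ?_
    have h1 : Tendsto (fun t : ℝ≥0 => (t : ℝ)⁻¹ * (Real.exp (-(t * lam i)) - 1) * ⟪e i, x⟫)
        (𝓝[>] 0) (𝓝 ⟪e i, y⟫) := by
      have := ((innerSL ℝ (e i)).continuous.tendsto y).comp h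
      refine this.congr fun t => ?_
      rw [Function.comp_apply, innerSL_apply_apply, inner_smul_right, inner_sub_right,
        inner_diagSemigroup]
      ring
    have h2 := tendsto_nhds_unique h1 ((tendsto_slope_exp_neg (lam i)).mul_const ⟪e i, x⟫)
    rw [inner_neg_right, hRe, h2]
    field_simp [(hlam i).ne']

/-- A compact symmetric operator is diagonal in some Hilbert basis. -/
theorem exists_hilbertBasis_eigenvectors {H : Type u} [NormedAddCommGroup H]
    [InnerProductSpace ℝ H] [CompleteSpace H] {R : H →L[ℝ] H}
    (hc : IsCompactOperator R) (hs : (R : H →ₗ[ℝ] H).IsSymmetric) :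
    ∃ (κ : Type u) (e : HilbertBasis κ ℝ H) (μ : κ → ℝ), ∀ k, R (e k) = μ k • e k := by
  let E : ℝ → Submodule ℝ H := fun μ => Module.End.eigenspace (R : Module.End ℝ H) μ
  have hE : ∀ μ, CompleteSpace (E μ) := fun μ => by
    have : IsClosed ((E μ : Submodule ℝ H) : Set H) := by
      have : ((E μ : Submodule ℝ H) : Set H) = {x | R x = μ • x} := by
        ext x
        exact Module.End.mem_eigenspace_iff
      rw [this]
      exact isClosed_eq R.continuous (continuous_const_smul μ)
    exact this.completeSpace_coe
  -- Each eigenspace is closed, hence has its own Hilbert basis. Their union over all real `μ` is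
  -- orthonormal because the eigenspaces are mutually orthogonal; values `μ` that are not
  -- eigenvalues contribute nothing.
  choose w v hv using fun μ => exists_hilbertBasis ℝ (E μ)
  have hor := (hs.orthogonalFamily_eigenspaces).orthonormal_sigma_orthonormal
    (fun μ => (v μ).orthonormal)
  refine ⟨Σ μ, w μ, HilbertBasis.mkOfOrthogonalEqBot hor ?_, fun k => k.1, fun k => ?_⟩
  · rw [eq_bot_iff]
    intro x hx
    rw [← ContinuousLinearMap.orthogonalComplement_iSup_eigenspaces_eq_bot hc hs,
      ← Submodule.iInf_orthogonal, Submodule.mem_iInf]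
    intro μ y hy
    -- Expanding `y` in the basis of its eigenspace shows `⟪x, y⟫ = 0`. Thus `x` is orthogonal to
    -- every eigenspace and vanishes by the spectral theorem.
    have h1 := ((v μ).hasSum_repr ⟨y, hy⟩).mapL ((innerSL ℝ x).comp (E μ).subtypeL)
    have h2 : (fun i => ((innerSL ℝ x).comp (E μ).subtypeL) ((v μ).repr ⟨y, hy⟩ i • v μ i))
        = fun _ => 0 := by
      funext i
      rw [map_smul]
      have := Submodule.inner_right_of_mem_orthogonal
        (Submodule.subset_span (mem_range_self (⟨μ, i⟩ : Σ μ, w μ))) hx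
      simp only [ContinuousLinearMap.comp_apply, Submodule.subtypeL_apply, innerSL_apply_apply]
      rw [real_inner_comm]
      simpa using Or.inr this
    rw [h2] at h1
    have := h1.unique hasSum_zero
    rw [real_inner_comm]
    simpa using this
  · rw [HilbertBasis.coe_mkOfOrthogonalEqBot]
    exact Module.End.mem_eigenspace_iff.1 (v k.1 k.2).2

/-- The negative of the inverse of a compact, symmetric, positive definite operator generates a
compact analytic semigroup of self-adjoint contractions. -/
theorem exists_semigroup_of_compact [CompleteSpace H] {R : H →L[ℝ] H}
    (hc : IsCompactOperator R) (hs : ∀ x y, ⟪R x, y⟫ = ⟪x, R y⟫)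
    (hpos : ∀ x, x ≠ 0 → 0 < ⟪R x, x⟫) {A : H →ₗ.[ℝ] H}
    (hA : ∀ x y, (x, y) ∈ A.graph ↔ x = -R y) :
    ∃ T : ℝ≥0 → H →L[ℝ] H, IsC0Semigroup T ∧ IsGenerator A T ∧ (∀ t, ‖T t‖ ≤ 1) ∧
      IsAnalyticSemigroup (Real.pi / 2) T ∧ (∀ t, IsSelfAdjoint (T t)) ∧
      (∀ t, 0 < t → IsCompactOperator (T t)) := by
  obtain ⟨κ, e, μ, hμ⟩ := exists_hilbertBasis_eigenvectors hc hs
  -- Positive definiteness of `R` excludes zero and negative eigenvalues, so the numbers `(μ k)⁻¹`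
  -- are legitimate positive decay rates.
  have hμpos : ∀ k, 0 < (μ k)⁻¹ := fun k => by
    have h1 : ‖e k‖ = 1 := e.orthonormal.1 k
    have := hpos (e k) (by rw [← norm_ne_zero_iff, h1]; exact one_ne_zero)
    rw [hμ, real_inner_smul_left, real_inner_self_eq_norm_sq, h1] at this
    exact inv_pos.2 (by simpa using this)
  have hRe : ∀ x k, ⟪e k, R x⟫ = ((μ k)⁻¹)⁻¹ * ⟪e k, x⟫ := fun x k => by
    rw [← hs, hμ, real_inner_smul_left, inv_inv]
  exact ⟨diagSemigroup e fun k => (hμpos k).le, isC0Semigroup_diagSemigroup e _,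
    isGenerator_diagSemigroup e hμpos hRe hA, norm_diagSemigroup_le e _,
    isAnalyticSemigroup_diagSemigroup e _, isSelfAdjoint_diagSemigroup e _,
    fun t ht => isCompactOperator_diagSemigroup e hμpos hc hRe ht⟩

end SemigroupOfCompact
-- Calculus, traces and embeddings in `H¹(0,1)`
section Sobolev

/-- A test function on `(0,1)` with vanishing integral is the derivative of a test function. -/
theorem exists_test_primitive {η : ℝ → ℝ} (hη : ContDiff ℝ ∞ η) (hc : HasCompactSupport η)
    (ht : tsupport η ⊆ Ioo (0 : ℝ) 1) (hi : ∫ x, η x = 0) :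
    ∃ Φ : ℝ → ℝ, ContDiff ℝ ∞ Φ ∧ HasCompactSupport Φ ∧ tsupport Φ ⊆ Ioo (0 : ℝ) 1 ∧
      deriv Φ = η := by
  -- The support sits in some `[a,c]` inside `(0,1)`; to the right of `c` the primitive equals the
  -- total integral, which is zero.
  obtain ⟨a, c, ha, hc1, hsupp⟩ : ∃ a c : ℝ, 0 < a ∧ c < 1 ∧ ∀ x, x ∉ Icc a c → η x = 0 := by
    rcases (tsupport η).eq_empty_or_nonempty with h | hne
    · exact ⟨1 / 2, 1 / 2, by norm_num, by norm_num, fun x _ =>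
        image_eq_zero_of_notMem_tsupport (by simp [h])⟩
    · obtain ⟨a, haK, ha⟩ := hc.isCompact.exists_isLeast hne
      obtain ⟨c, hcK, hc⟩ := hc.isCompact.exists_isGreatest hne
      exact ⟨a, c, (ht haK).1, (ht hcK).2, fun x hx =>
        image_eq_zero_of_notMem_tsupport fun h => hx ⟨ha h, hc h⟩⟩
  set Φ : ℝ → ℝ := fun x => ∫ t in (0 : ℝ)..x, η t with hΦ
  have hΦd : ∀ x, HasDerivAt Φ (η x) x := fun x =>
    intervalIntegral.integral_hasDerivAt_right (hη.continuous.intervalIntegrable _ _)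
      (hη.continuous.stronglyMeasurableAtFilter _ _) hη.continuous.continuousAt
  have hΦe : deriv Φ = η := funext fun x => (hΦd x).deriv
  have hΦ0 : ∀ x, x ∉ Icc a c → Φ x = 0 := by
    intro x hx
    rw [mem_Icc, not_and_or, not_le, not_le] at hx
    rcases hx with hx | hx
    · apply intervalIntegral.integral_zero_ae
      refine Filter.Eventually.of_forall fun t ht => hsupp t fun ht' => ?_
      rcases mem_uIoc.1 ht with h | h
      · linarith [ht'.1, h.2]
      · linarith [ht'.1, h.2]
    · by_cases hx0 : 0 ≤ x
      · simp only [hΦ]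
        rw [intervalIntegral.integral_of_le hx0,
          setIntegral_eq_integral_of_forall_compl_eq_zero, hi]
        intro t ht
        exact hsupp t fun ht' => ht ⟨lt_of_lt_of_le ha ht'.1, by linarith [ht'.2]⟩
      · apply intervalIntegral.integral_zero_ae
        refine Filter.Eventually.of_forall fun t ht => hsupp t fun ht' => ?_
        rcases mem_uIoc.1 ht with h | h
        · linarith [ht'.1, h.2]
        · linarith [ht'.1, h.2]
  refine ⟨Φ, contDiff_infty_iff_deriv.2 ⟨fun x => (hΦd x).differentiableAt, hΦe ▸ hη⟩,
    HasCompactSupport.intro isCompact_Icc hΦ0, ?_, hΦe⟩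
  have : tsupport Φ ⊆ Icc a c :=
    closure_minimal (fun x hx => by_contra fun h => hx (hΦ0 x h)) isClosed_Icc
  exact this.trans fun x hx => ⟨lt_of_lt_of_le ha hx.1, lt_of_le_of_lt hx.2 hc1⟩

theorem integral_test_eq {f : ℝ → ℝ} (hf : tsupport f ⊆ Ioo (0 : ℝ) 1) :
    ∫ x, f x ∂μI = ∫ x, f x :=
  setIntegral_eq_integral_of_forall_compl_eq_zero fun _ hx =>
    by_contra fun hne => hx (hf (subset_tsupport f hne))

/-- The constant function `k`, as an element of `L²(0,1)`. -/
def constL2 (k : ℝ) : L2I := Lp.const 2 μI k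

theorem constL2_coe (k : ℝ) : (constL2 k : ℝ → ℝ) =ᵐ[μI] fun _ => k := Lp.coeFn_const _ _ _

/-- A function with vanishing weak derivative is constant. -/
theorem IsWeakDeriv.eq_const {u : L2I} (hu : IsWeakDeriv u 0) : ∃ k, u = constL2 k := by
  obtain ⟨ψ, hψ1, hψ2, hψ3, hψ4⟩ : ∃ ψ : ℝ → ℝ, ContDiff ℝ ∞ ψ ∧ HasCompactSupport ψ ∧
      tsupport ψ ⊆ Ioo (0 : ℝ) 1 ∧ ∫ x, ψ x = 1 := by
    let f : ContDiffBump (1 / 2 : ℝ) := ⟨1 / 8, 1 / 4, by norm_num, by norm_num⟩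
    refine ⟨f.normed volume, f.contDiff_normed, f.hasCompactSupport_normed, ?_, f.integral_normed⟩
    rw [f.tsupport_normed_eq, Real.closedBall_eq_Icc]
    intro x hx
    have h1 := hx.1
    have h2 := hx.2
    simp only [f] at h1 h2
    constructor <;> linarith
  refine ⟨∫ x, u x * ψ x ∂μI, L2I.eq_of_test fun φ h1 h2 h3 => ?_⟩
  set k := ∫ x, u x * ψ x ∂μI
  set m : ℝ := ∫ x, φ x with hm
  -- Subtracting `m ψ` makes the integral of `φ` vanish, so the difference is `Φ'` for a test
  -- function `Φ`. Testing `u' = 0` against `Φ` gives `∫ u φ = (∫ u ψ) (∫ φ)`.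
  obtain ⟨Φ, hΦ1, hΦ2, hΦ3, hΦ4⟩ := exists_test_primitive (η := fun x => φ x - m * ψ x)
    (h1.sub (contDiff_const.mul hψ1)) (h2.sub hψ2.mul_left)
    ((tsupport_sub φ _).trans (union_subset h3 ((tsupport_mul_subset_right).trans hψ3))) (by
      rw [integral_sub (h1.continuous.integrable_of_hasCompactSupport h2)
        ((hψ1.continuous.integrable_of_hasCompactSupport hψ2).const_mul m),
        integral_const_mul, hψ4, hm]
      ring)
  have h := hu Φ hΦ1 hΦ2 hΦ3
  have hz : ∫ x, (0 : L2I) x * Φ x ∂μI = 0 := by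
    refine integral_eq_zero_of_ae ?_
    filter_upwards [Lp.coeFn_zero ℝ 2 μI] with x hx
    rw [hx, Pi.zero_apply, zero_mul]
  have hexp : (fun x => u x * (φ x - m * ψ x)) = fun x => u x * φ x - m * (u x * ψ x) := by
    ext x; ring
  rw [hz, neg_zero, hΦ4, hexp, integral_sub (integrable_mul_of_continuous u h1.continuous h2)
    ((integrable_mul_of_continuous u hψ1.continuous hψ2).const_mul m), integral_const_mul] at h
  have hR : ∫ x, constL2 k x * φ x ∂μI = k * m := by
    rw [hm, ← integral_test_eq h3, ← integral_const_mul]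
    refine integral_congr_ae ?_
    filter_upwards [constL2_coe k] with x hx
    rw [hx]
  rw [hR]
  linarith

/-- The affine-type function `x ↦ p + ∫₀ˣ g`. -/
def affInt (p : ℝ) (g : L2I) (x : ℝ) : ℝ := p + ∫ t in (0 : ℝ)..x, g t

theorem intervalIntegrable_L2I (g : L2I) : IntervalIntegrable g volume 0 1 := by
  rw [intervalIntegrable_iff_integrableOn_Ioo_of_le zero_le_one]
  exact L2I.integrable g

theorem affInt_ac (p : ℝ) (g : L2I) : AbsolutelyContinuousOnInterval (affInt p g) 0 1 := by
  have h1 := (intervalIntegrable_L2I g).absolutelyContinuousOnInterval_intervalIntegral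
    (c := 0) (by simp)
  have h2 : AbsolutelyContinuousOnInterval (fun _ : ℝ => p) 0 1 :=
    (contDiff_const (n := 1)).contDiffOn.absolutelyContinuousOnInterval
  exact h2.add h1

theorem affInt_continuousOn (p : ℝ) (g : L2I) : ContinuousOn (affInt p g) (Icc 0 1) := by
  simpa [uIcc_of_le] using (affInt_ac p g).continuousOn

theorem deriv_affInt (p : ℝ) (g : L2I) :
    ∀ᵐ x, x ∈ uIcc (0 : ℝ) 1 → deriv (affInt p g) x = g x := by
  filter_upwards [(intervalIntegrable_L2I g).ae_hasDerivAt_integral] with x hx hx'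
  exact ((hx hx' 0 (by simp)).const_add p).deriv

theorem integral_μI (f : ℝ → ℝ) : ∫ x, f x ∂μI = ∫ x in (0 : ℝ)..1, f x := by
  rw [intervalIntegral.integral_of_le zero_le_one, integral_Ioc_eq_integral_Ioo]

theorem memLp_of_continuousOn {f : ℝ → ℝ} (hf : ContinuousOn f (Icc 0 1)) : MemLp f 2 μI := by
  obtain ⟨K, hK⟩ := isCompact_Icc.exists_bound_of_continuousOn hf
  refine MemLp.of_bound
    ((hf.mono Ioo_subset_Icc_self).aestronglyMeasurable measurableSet_Ioo) K ?_
  rw [ae_restrict_iff' measurableSet_Ioo]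
  exact Eventually.of_forall fun x hx => hK x (Ioo_subset_Icc_self hx)

/-- The integration by parts formula for `p + ∫₀ˣ g` and `q + ∫₀ˣ h`. -/
theorem affInt_parts (p q : ℝ) (g h : L2I) :
    ∫ x, affInt p g x * h x ∂μI
      = affInt p g 1 * affInt q h 1 - p * q - ∫ x, g x * affInt q h x ∂μI := by
  have h1 := (affInt_ac p g).integral_mul_deriv_eq_deriv_mul (affInt_ac q h)
  have e1 : ∫ x in (0 : ℝ)..1, affInt p g x * deriv (affInt q h) x
      = ∫ x in (0 : ℝ)..1, affInt p g x * h x := by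
    apply intervalIntegral.integral_congr_ae
    filter_upwards [deriv_affInt q h] with x hx hx'
    rw [hx (uIoc_subset_uIcc hx')]
  have e2 : ∫ x in (0 : ℝ)..1, deriv (affInt p g) x * affInt q h x
      = ∫ x in (0 : ℝ)..1, g x * affInt q h x := by
    apply intervalIntegral.integral_congr_ae
    filter_upwards [deriv_affInt p g] with x hx hx'
    rw [hx (uIoc_subset_uIcc hx')]
  rw [integral_μI, integral_μI, ← e1, ← e2, h1]
  simp [affInt]

/-- The class of `p + ∫₀ˣ g` in `L²(0,1)`. -/
def affL2 (p : ℝ) (g : L2I) : L2I := (memLp_of_continuousOn (affInt_continuousOn p g)).toLp _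

theorem isContRep_affL2 (p : ℝ) (g : L2I) : IsContRep (affL2 p g) (affInt p g) :=
  ⟨affInt_continuousOn p g, MemLp.coeFn_toLp _⟩

theorem isWeakDeriv_affL2 (p : ℝ) (g : L2I) : IsWeakDeriv (affL2 p g) g := by
  intro φ h1 h2 h3
  have hφac : AbsolutelyContinuousOnInterval φ 0 1 :=
    (h1.of_le (by simp)).contDiffOn.absolutelyContinuousOnInterval
  have z0 : φ 0 = 0 := by
    by_contra h; exact absurd (h3 (subset_tsupport φ h)).1 (lt_irrefl _)
  have z1 : φ 1 = 0 := by
    by_contra h; exact absurd (h3 (subset_tsupport φ h)).2 (lt_irrefl _)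
  have e : ∫ x, affL2 p g x * deriv φ x ∂μI = ∫ x, affInt p g x * deriv φ x ∂μI := by
    refine integral_congr_ae ?_
    filter_upwards [(isContRep_affL2 p g).2] with x hx
    rw [hx]
  rw [e, integral_μI, integral_μI, (affInt_ac p g).integral_mul_deriv_eq_deriv_mul hφac, z0, z1]
  have : ∫ x in (0 : ℝ)..1, deriv (affInt p g) x * φ x = ∫ x in (0 : ℝ)..1, g x * φ x := by
    apply intervalIntegral.integral_congr_ae
    filter_upwards [deriv_affInt p g] with x hx hx'
    rw [hx (uIoc_subset_uIcc hx')]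
  rw [this]; ring

/-- The function `p + ∫₀ˣ g` as an element of `H¹(0,1)`. -/
def affH1 (p : ℝ) (g : L2I) : H1 := ⟨affL2 p g, g, isWeakDeriv_affL2 p g⟩

theorem weakDeriv_eq {u : H1} {g : L2I} (h : IsWeakDeriv u g) : weakDeriv u = g :=
  (weakDeriv_spec u).unique h

theorem weakDeriv_affH1 (p : ℝ) (g : L2I) : weakDeriv (affH1 p g) = g :=
  weakDeriv_eq (isWeakDeriv_affL2 p g)

theorem evalAt_affH1 (p : ℝ) (g : L2I) (x : Icc (0 : ℝ) 1) :
    evalAt x (affH1 p g) = affInt p g x :=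
  (contRep_spec (affH1 p g)).eqOn (isContRep_affL2 p g) x.2

theorem evalAt_pt0_affH1 (p : ℝ) (g : L2I) : evalAt pt0 (affH1 p g) = p := by
  rw [evalAt_affH1]
  simp [affInt, pt0]

/-- The fundamental theorem of calculus in `H¹(0,1)`. -/
theorem eq_affH1 (u : H1) : u = affH1 (evalAt pt0 u) (weakDeriv u) := by
  set g := weakDeriv u with hg
  have h0 : IsWeakDeriv ((u - affH1 0 g : H1) : L2I) 0 := by
    have := weakDeriv_spec (u - affH1 0 g)
    rwa [map_sub, weakDeriv_affH1, ← hg, sub_self] at this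
  obtain ⟨k, hk⟩ := h0.eq_const
  have hu : u = affH1 k g := by
    apply Subtype.ext
    apply Lp.ext
    have h1 : (u : L2I) = constL2 k + affL2 0 g := by
      rw [← hk]
      change _ = ((u : L2I) - affL2 0 g) + affL2 0 g
      abel
    rw [h1]
    filter_upwards [Lp.coeFn_add (constL2 k) (affL2 0 g), constL2_coe k,
      (isContRep_affL2 0 g).2, (isContRep_affL2 k g).2] with x h1 h2 h3 h4
    change _ = (affL2 k g) x
    rw [h1, Pi.add_apply, h2, h3, h4]
    simp [affInt]
  have h1 : evalAt pt0 u = k := by rw [hu, evalAt_pt0_affH1]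
  rw [h1]
  exact hu

theorem evalAt_eq (u : H1) (x : Icc (0 : ℝ) 1) :
    evalAt x u = affInt (evalAt pt0 u) (weakDeriv u) x := by
  conv_lhs => rw [eq_affH1 u, evalAt_affH1]

theorem coe_ae_eq_evalAt (u : H1) :
    ((u : L2I) : ℝ → ℝ) =ᵐ[μI] affInt (evalAt pt0 u) (weakDeriv u) := by
  have := (isContRep_affL2 (evalAt pt0 u) (weakDeriv u)).2
  have h : (u : L2I) = affL2 (evalAt pt0 u) (weakDeriv u) := congrArg Subtype.val (eq_affH1 u)
  rw [← h] at this
  exact this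

/-- Integration by parts in `H¹(0,1)`. -/
theorem inner_weakDeriv (u v : H1) :
    ⟪(u : L2I), weakDeriv v⟫ = evalAt pt1 u * evalAt pt1 v - evalAt pt0 u * evalAt pt0 v
      - ⟪weakDeriv u, (v : L2I)⟫ := by
  rw [← integral_mul_eq_inner, ← integral_mul_eq_inner, evalAt_eq u pt1, evalAt_eq v pt1]
  have := affInt_parts (evalAt pt0 u) (evalAt pt0 v) (weakDeriv u) (weakDeriv v)
  have e1 : ∫ x, (u : L2I) x * weakDeriv v x ∂μI
      = ∫ x, affInt (evalAt pt0 u) (weakDeriv u) x * weakDeriv v x ∂μI := by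
    refine integral_congr_ae ?_
    filter_upwards [coe_ae_eq_evalAt u] with x hx
    rw [hx]
  have e2 : ∫ x, weakDeriv u x * (v : L2I) x ∂μI
      = ∫ x, weakDeriv u x * affInt (evalAt pt0 v) (weakDeriv v) x ∂μI := by
    refine integral_congr_ae ?_
    filter_upwards [coe_ae_eq_evalAt v] with x hx
    rw [hx]
  rw [e1, e2]
  exact this

/-- Hölder continuity of `p + ∫₀ˣ g`. -/
theorem abs_affInt_sub_le (p : ℝ) (g : L2I) {x y : ℝ} (hx : x ∈ Icc (0 : ℝ) 1)
    (hy : y ∈ Icc (0 : ℝ) 1) : |affInt p g x - affInt p g y| ≤ √|x - y| * ‖g‖ := by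
  wlog hxy : y ≤ x generalizing x y
  · rw [abs_sub_comm, abs_sub_comm x y]
    exact this hy hx (le_of_not_ge hxy)
  have hi : ∀ z ∈ Icc (0 : ℝ) 1, IntervalIntegrable g volume 0 z := fun z hz =>
    (intervalIntegrable_L2I g).mono_set (by
      rw [uIcc_of_le hz.1, uIcc_of_le zero_le_one]
      exact Icc_subset_Icc_right hz.2)
  -- The increment is the inner product of `g` with the indicator of `(y,x)`, so Cauchy–Schwarz
  -- produces the factor `√|x - y|`.
  have h1 : affInt p g x - affInt p g y
      = ⟪indicatorConstLp 2 (measurableSet_Ioo (a := y) (b := x)) (measure_ne_top μI _) (1 : ℝ),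
        g⟫ := by
    rw [L2.inner_indicatorConstLp_one, Measure.restrict_restrict measurableSet_Ioo,
      inter_eq_left.2 (Ioo_subset_Ioo hy.1 hx.2), ← integral_Ioc_eq_integral_Ioo,
      ← intervalIntegral.integral_of_le hxy, affInt, affInt, add_sub_add_left_eq_sub,
      intervalIntegral.integral_interval_sub_left (hi x hx) (hi y hy)]
  rw [h1]
  refine (abs_real_inner_le_norm _ _).trans (mul_le_mul_of_nonneg_right ?_ (norm_nonneg _))
  refine norm_indicatorConstLp_le.trans ?_
  have : μI.real (Ioo y x) ≤ |x - y| := by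
    rw [measureReal_restrict_apply measurableSet_Ioo, inter_eq_left.2 (Ioo_subset_Ioo hy.1 hx.2),
      Real.volume_real_Ioo_of_le hxy, abs_of_nonneg (sub_nonneg.2 hxy)]
  rw [norm_one, one_mul, Real.sqrt_eq_rpow]
  simp only [ENNReal.toReal_ofNat]
  gcongr

theorem abs_evalAt_sub_le (u : H1) (x y : Icc (0 : ℝ) 1) :
    |evalAt x u - evalAt y u| ≤ √|(x : ℝ) - y| * ‖weakDeriv u‖ := by
  rw [evalAt_eq u x, evalAt_eq u y]
  exact abs_affInt_sub_le _ _ x.2 y.2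

theorem abs_evalAt_le (u : H1) (x : Icc (0 : ℝ) 1) :
    |evalAt x u| ≤ |evalAt pt0 u| + ‖weakDeriv u‖ := by
  have h := abs_evalAt_sub_le u x pt0
  have h1 : √|(x : ℝ) - (pt0 : Icc (0 : ℝ) 1)| ≤ 1 := by
    rw [Real.sqrt_le_one]
    simpa [pt0, abs_of_nonneg x.2.1] using x.2.2
  have h2 := mul_le_mul_of_nonneg_right h1 (norm_nonneg (weakDeriv u))
  have h3 := abs_sub_abs_le_abs_sub (evalAt x u) (evalAt pt0 u)
  linarith

theorem norm_le_of_bound {u : L2I} {K : ℝ} (hK : 0 ≤ K) (h : ∀ᵐ x ∂μI, |u x| ≤ K) :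
    ‖u‖ ≤ K := by
  have := Lp.norm_le_of_ae_bound (f := u) hK h
  simpa [measureUnivNNReal] using this

/-- A Poincaré-type inequality, valid because `(0,1)` has measure one and `u` differs from `u(0)`
pointwise by at most `‖u'‖`. The coercivity of the form rests on it. -/
theorem norm_coe_le (u : H1) : ‖(u : L2I)‖ ≤ |evalAt pt0 u| + ‖weakDeriv u‖ := by
  refine norm_le_of_bound (by positivity) ?_
  filter_upwards [coe_ae_eq_evalAt u, ae_restrict_mem measurableSet_Ioo] with x hx hx'
  rw [hx, ← evalAt_eq u ⟨x, Ioo_subset_Icc_self hx'⟩]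
  exact abs_evalAt_le u _

/-- The trace inequality at `0`. -/
theorem abs_evalAt_pt0_le (u : H1) : |evalAt pt0 u| ≤ ‖(u : L2I)‖ + ‖weakDeriv u‖ := by
  have h1 : (u : L2I) = constL2 (evalAt pt0 u) + affL2 0 (weakDeriv u) := by
    apply Lp.ext
    filter_upwards [Lp.coeFn_add (constL2 (evalAt pt0 u)) (affL2 0 (weakDeriv u)),
      constL2_coe (evalAt pt0 u), (isContRep_affL2 0 (weakDeriv u)).2,
      coe_ae_eq_evalAt u] with x h1 h2 h3 h4
    rw [h1, Pi.add_apply, h2, h3, h4]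
    simp [affInt]
  have h2 : ‖affL2 0 (weakDeriv u)‖ ≤ ‖weakDeriv u‖ := by
    have := norm_coe_le (affH1 0 (weakDeriv u))
    rw [evalAt_pt0_affH1, weakDeriv_affH1] at this
    rw [abs_zero, zero_add] at this
    exact this
  have h3 : ‖constL2 (evalAt pt0 u)‖ = |evalAt pt0 u| := by
    rw [constL2, Lp.norm_const']
    · simp
    · norm_num
    · norm_num
  have h4 : constL2 (evalAt pt0 u) = (u : L2I) - affL2 0 (weakDeriv u) := by
    rw [h1]; abel
  rw [← h3, h4]
  exact (norm_sub_le _ _).trans (add_le_add_right h2 _)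

/-- The weak derivative is a closed operator. -/
theorem IsWeakDeriv.of_tendsto {u g : ℕ → L2I} {u₀ g₀ : L2I} (h : ∀ n, IsWeakDeriv (u n) (g n))
    (hu : Tendsto u atTop (𝓝 u₀)) (hg : Tendsto g atTop (𝓝 g₀)) : IsWeakDeriv u₀ g₀ := by
  intro φ h1 h2 h3
  -- Pairing with a test function is an inner product in `L²`, so both sides of the defining
  -- identity pass to the limit.
  have key : ∀ ψ : ℝ → ℝ, Continuous ψ → HasCompactSupport ψ → ∀ (v : ℕ → L2I) (v₀ : L2I),
      Tendsto v atTop (𝓝 v₀) →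
      Tendsto (fun n => ∫ x, v n x * ψ x ∂μI) atTop (𝓝 (∫ x, v₀ x * ψ x ∂μI)) := by
    intro ψ hψ hψc v v₀ hv
    have hm : MemLp ψ 2 μI := hψ.memLp_of_hasCompactSupport hψc
    have e : ∀ w : L2I, ∫ x, w x * ψ x ∂μI = ⟪w, hm.toLp ψ⟫ := fun w => by
      rw [← integral_mul_eq_inner]
      refine integral_congr_ae ?_
      filter_upwards [hm.coeFn_toLp] with x hx
      rw [hx]
    simp only [e]
    exact hv.inner tendsto_const_nhds
  have t1 := key (deriv φ) (h1.continuous_deriv (by simp)) h2.deriv u u₀ hu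
  have t2 := (key φ h1.continuous h2 g g₀ hg).neg
  refine tendsto_nhds_unique t1 (t2.congr fun n => (h n φ h1 h2 h3).symm)

end Sobolev
-- Coercivity, continuity and closedness of the form
section Form

theorem L_apply_zero (u : H1) : L u 0 = evalAt pt0 u := rfl

theorem L_apply_one (u : H1) : L u 1 = evalAt pt1 u := rfl

theorem V.fst_coe (f : V) : ((V.fst f : H1) : L2I) = (f : XX).fst := rfl

theorem V.snd_eq (f : V) : (f : XX).snd = L (V.fst f) := f.2.2.symm

theorem norm_sq_V (f : V) : ‖(f : XX)‖ ^ 2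
    = ‖((V.fst f : H1) : L2I)‖ ^ 2 + (evalAt pt0 (V.fst f) ^ 2 + evalAt pt1 (V.fst f) ^ 2) := by
  rw [WithLp.prod_norm_sq_eq_of_L2, V.fst_coe, V.snd_eq, EuclideanSpace.norm_sq_eq,
    Fin.sum_univ_two, L_apply_zero, L_apply_one, Real.norm_eq_abs, Real.norm_eq_abs, sq_abs,
    sq_abs]

theorem formA_apply (b : Fin 2 → ℝ) (f g : V) :
    formA b f g = ⟪weakDeriv (V.fst f), weakDeriv (V.fst g)⟫
      + b 0 * evalAt pt0 (V.fst f) * evalAt pt0 (V.fst g)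
      + b 1 * evalAt pt1 (V.fst f) * evalAt pt1 (V.fst g) := by
  rw [← integral_mul_eq_inner]
  rfl

theorem formA_self (b : Fin 2 → ℝ) (f : V) :
    formA b f f = ‖weakDeriv (V.fst f)‖ ^ 2
      + b 0 * evalAt pt0 (V.fst f) ^ 2 + b 1 * evalAt pt1 (V.fst f) ^ 2 := by
  rw [formA_apply, real_inner_self_eq_norm_sq]
  ring

theorem formA_comm (b : Fin 2 → ℝ) (f g : V) : formA b f g = formA b g f := by
  rw [formA_apply, formA_apply, real_inner_comm]
  ring

variable {b : Fin 2 → ℝ}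

theorem norm_weakDeriv_sq_le_formA (hb : ∀ i, 0 < b i) (f : V) :
    ‖weakDeriv (V.fst f)‖ ^ 2 ≤ formA b f f := by
  rw [formA_self]
  nlinarith [mul_nonneg (hb 0).le (sq_nonneg (evalAt pt0 (V.fst f))),
    mul_nonneg (hb 1).le (sq_nonneg (evalAt pt1 (V.fst f)))]

theorem formA_nonneg (hb : ∀ i, 0 < b i) (f : V) : 0 ≤ formA b f f :=
  (sq_nonneg _).trans (norm_weakDeriv_sq_le_formA hb f)

/-- The form is coercive with respect to the norm of the Hilbert space. -/
theorem formA_coercive (hb : ∀ i, 0 < b i) :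
    ∃ K, 0 < K ∧ ∀ f : V, ‖(f : XX)‖ ^ 2 ≤ K * formA b f f := by
  -- Each of `‖u‖²` and `u(1)²` is at most `2 u(0)² + 2 ‖u'‖²`; adding the remaining `u(0)²` gives
  -- `4 ‖u'‖² + 5 u(0)²`. The boundary term at `0` alone supplies the control of `u(0)`.
  refine ⟨4 + 5 / b 0, by have := hb 0; positivity, fun f => ?_⟩
  have h0 := hb 0
  set u := V.fst f
  have e1 : ‖(u : L2I)‖ ^ 2 ≤ (|evalAt pt0 u| + ‖weakDeriv u‖) ^ 2 :=
    pow_le_pow_left₀ (norm_nonneg _) (norm_coe_le u) 2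
  have e2 : evalAt pt1 u ^ 2 ≤ (|evalAt pt0 u| + ‖weakDeriv u‖) ^ 2 := by
    rw [← sq_abs]
    exact pow_le_pow_left₀ (abs_nonneg _) (abs_evalAt_le u pt1) 2
  have e3 : (|evalAt pt0 u| + ‖weakDeriv u‖) ^ 2
      ≤ 2 * evalAt pt0 u ^ 2 + 2 * ‖weakDeriv u‖ ^ 2 := by
    rw [← sq_abs (evalAt pt0 u)]
    nlinarith [sq_nonneg (|evalAt pt0 u| - ‖weakDeriv u‖)]
  have e4 : ‖weakDeriv u‖ ^ 2 + b 0 * evalAt pt0 u ^ 2 ≤ formA b f f := by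
    rw [formA_self]
    nlinarith [mul_nonneg (hb 1).le (sq_nonneg (evalAt pt1 u))]
  calc ‖(f : XX)‖ ^ 2 ≤ 4 * ‖weakDeriv u‖ ^ 2 + 5 * evalAt pt0 u ^ 2 := by
        rw [norm_sq_V]; linarith
    _ ≤ (4 + 5 / b 0) * (‖weakDeriv u‖ ^ 2 + b 0 * evalAt pt0 u ^ 2) := by
        have : (4 + 5 / b 0) * (‖weakDeriv u‖ ^ 2 + b 0 * evalAt pt0 u ^ 2)
            = 4 * ‖weakDeriv u‖ ^ 2 + 5 * evalAt pt0 u ^ 2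
              + (5 / b 0 * ‖weakDeriv u‖ ^ 2 + 4 * (b 0 * evalAt pt0 u ^ 2)) := by
          field_simp
          ring
        rw [this]
        have : 0 ≤ 5 / b 0 * ‖weakDeriv u‖ ^ 2 + 4 * (b 0 * evalAt pt0 u ^ 2) := by positivity
        linarith
    _ ≤ _ := by gcongr

/-- Cauchy–Schwarz for a positive symmetric form: the quadratic `t ↦ a(x + t y, x + t y)` is
nonnegative, so its discriminant is not positive. Hence the constant `1`. -/
theorem isContinuousForm_formA (hb : ∀ i, 0 < b i) : IsContinuousForm (formA b) := by
  refine ⟨1, fun x y => ?_⟩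
  have hq : ∀ t : ℝ, 0 ≤ formA b y y * (t * t) + 2 * formA b x y * t + formA b x x := fun t => by
    have h := formA_nonneg hb (x + t • y)
    simp only [map_add, map_smul, LinearMap.add_apply, LinearMap.smul_apply, smul_eq_mul] at h
    rw [formA_comm b y x] at h
    linarith
  have hd := discrim_le_zero hq
  rw [discrim] at hd
  have hcs : formA b x y ^ 2 ≤ formA b x x * formA b y y := by linarith
  rw [one_mul, ← Real.sqrt_mul (by
    rw [formNormSq]; have := formA_nonneg hb x; positivity), ← Real.sqrt_sq_eq_abs]
  refine Real.sqrt_le_sqrt (hcs.trans ?_)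
  refine mul_le_mul ?_ ?_ (formA_nonneg hb y)
    (by rw [formNormSq]; have := formA_nonneg hb x; positivity)
  · rw [formNormSq]; linarith [sq_nonneg ‖(x : XX)‖]
  · rw [formNormSq]; linarith [sq_nonneg ‖(y : XX)‖]

/-- The element `(u, L u)` of the form domain. -/
def V.mk (u : H1) : V := ⟨WithLp.toLp 2 ((u : L2I), L u), u.2, rfl⟩

theorem V.fst_mk (u : H1) : V.fst (V.mk u) = u := rfl

/-- The form norm is bounded by the norm of `H¹(0,1)`. -/
theorem formNormSq_le (hb : ∀ i, 0 < b i) (f : V) :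
    formNormSq (formA b) f ≤ (3 + b 0 + b 1)
      * (‖(V.fst f : L2I)‖ + 2 * ‖weakDeriv (V.fst f)‖) ^ 2 := by
  rw [formNormSq, formA_self, norm_sq_V]
  set u := V.fst f
  -- The weight `2` comes from the right endpoint: `|u(1)| ≤ |u(0)| + ‖u'‖ ≤ ‖u‖ + 2 ‖u'‖`.
  set S := ‖(u : L2I)‖ + 2 * ‖weakDeriv u‖ with hS
  have n1 := norm_nonneg (u : L2I)
  have n2 := norm_nonneg (weakDeriv u)
  have h0 : evalAt pt0 u ^ 2 ≤ S ^ 2 := by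
    rw [← sq_abs]
    exact pow_le_pow_left₀ (abs_nonneg _) ((abs_evalAt_pt0_le u).trans (by linarith)) 2
  have h1 : evalAt pt1 u ^ 2 ≤ S ^ 2 := by
    rw [← sq_abs]
    refine pow_le_pow_left₀ (abs_nonneg _) ((abs_evalAt_le u pt1).trans ?_) 2
    linarith [abs_evalAt_pt0_le u]
  have h2 : ‖(u : L2I)‖ ^ 2 ≤ S ^ 2 := pow_le_pow_left₀ n1 (by linarith) 2
  have h3 : ‖weakDeriv u‖ ^ 2 ≤ S ^ 2 := pow_le_pow_left₀ n2 (by linarith) 2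
  nlinarith [mul_le_mul_of_nonneg_left h0 (hb 0).le, mul_le_mul_of_nonneg_left h1 (hb 1).le,
    hb 1, sq_nonneg S, mul_nonneg (hb 1).le (sq_nonneg S)]

/-- A Cauchy sequence for the form norm has `uₙ` and `uₙ'` Cauchy in `L²`, and the limits are linked
because the weak derivative is closed. The boundary values need no separate argument: the trace
inequalities bound the form norm by the `H¹` norm. -/
theorem isClosedForm_formA (hb : ∀ i, 0 < b i) : IsClosedForm (formA b) := by
  intro x hx
  have cauchy : ∀ T : V →ₗ[ℝ] L2I, (∀ f, ‖T f‖ ^ 2 ≤ formNormSq (formA b) f) →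
      CauchySeq fun n => T (x n) := fun T hT => by
    rw [Metric.cauchySeq_iff]
    intro ε hε
    obtain ⟨N, hN⟩ := hx (ε ^ 2) (by positivity)
    refine ⟨N, fun m hm n hn => ?_⟩
    rw [dist_eq_norm, ← map_sub]
    exact lt_of_pow_lt_pow_left₀ 2 hε.le ((hT _).trans_lt (hN m hm n hn))
  have c1 := cauchy (H1.subtype ∘ₗ V.fst) fun f => by
    have := norm_sq_V f
    have := formA_nonneg hb f
    rw [formNormSq]
    simp only [LinearMap.comp_apply, Submodule.subtype_apply]
    nlinarith [sq_nonneg (evalAt pt0 (V.fst f)), sq_nonneg (evalAt pt1 (V.fst f))]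
  have c2 := cauchy (weakDeriv ∘ₗ V.fst) fun f => by
    have := norm_weakDeriv_sq_le_formA hb f
    rw [formNormSq]
    simp only [LinearMap.comp_apply]
    linarith [sq_nonneg ‖(f : XX)‖]
  obtain ⟨u, hu⟩ := cauchySeq_tendsto_of_complete c1
  obtain ⟨g, hg⟩ := cauchySeq_tendsto_of_complete c2
  have hw : IsWeakDeriv u g :=
    IsWeakDeriv.of_tendsto (fun n => weakDeriv_spec (V.fst (x n))) hu hg
  let U : H1 := ⟨u, g, hw⟩
  have hU : weakDeriv U = g := weakDeriv_eq hw
  refine ⟨V.mk U, ?_⟩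
  refine squeeze_zero (fun n => ?_) (fun n => formNormSq_le hb (x n - V.mk U)) ?_
  · rw [formNormSq]
    have := formA_nonneg hb (x n - V.mk U)
    positivity
  · have t1 : Tendsto (fun n => ‖((V.fst (x n - V.mk U) : H1) : L2I)‖) atTop (𝓝 0) :=
      tendsto_iff_norm_sub_tendsto_zero.1 hu
    have t2 : Tendsto (fun n => ‖weakDeriv (V.fst (x n - V.mk U))‖) atTop (𝓝 0) := by
      have := tendsto_iff_norm_sub_tendsto_zero.1 hg
      refine this.congr fun n => ?_
      rw [map_sub, map_sub, V.fst_mk, hU]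
      rfl
    simpa using ((t1.add (t2.const_mul 2)).pow 2).const_mul (3 + b 0 + b 1)

end Form

/-! ### Green's formula, solvability of `𝔸 w = y`, and self-adjointness -/

section Operator

theorem domA_le_V : domA ≤ V := fun _ hw => ⟨H2_le_H1 hw.1, hw.2⟩

/-- An element of `D(𝔸)`, as an element of the form domain. -/
def domA.toV (w : domA) : V := ⟨w, domA_le_V w.2⟩

theorem B_apply (b : Fin 2 → ℝ) (v : R2) (i : Fin 2) : B b v i = -b i * v i := by
  simp [B, Matrix.toEuclideanLin, Matrix.mulVec_diagonal]

/-- Green's formula. -/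
theorem formA_eq_neg_inner (b : Fin 2 → ℝ) (w : domA) (h : V) :
    formA b (domA.toV w) h = -⟪opA b w, (h : XX)⟫ := by
  rw [opA_apply, WithLp.prod_inner_apply, formA_apply]
  set u := V.fst (domA.toV w) with hu
  set v := V.fst h with hv
  have h2 : (h : XX).ofLp.2 = L v := V.snd_eq h
  have h1 : (h : XX).ofLp.1 = (v : L2I) := rfl
  have hs : domA.snd w = L u := V.snd_eq (domA.toV w)
  set d : H1 := derivH2 (domA.fst w) with hd
  have hdu : weakDeriv u = (d : L2I) := rfl
  have hA : Am (domA.fst w) = weakDeriv d := rfl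
  have hC0 : C (domA.fst w) 0 = evalAt pt0 d := rfl
  have hC1 : C (domA.fst w) 1 = -evalAt pt1 d := rfl
  -- Integration by parts for `d = u'` and `v` leaves `u'(1) v(1) - u'(0) v(0)`, which cancels
  -- against `⟪C u, L v⟫`.
  have key := inner_weakDeriv d v
  rw [h1, h2, hs, hdu]
  simp only [hA, key]
  rw [PiLp.inner_apply, Fin.sum_univ_two]
  simp only [PiLp.add_apply, B_apply, hC0, hC1, L_apply_zero, L_apply_one, RCLike.inner_apply,
    conj_trivial]
  ring

variable {b : Fin 2 → ℝ}

theorem opA_symmetric (b : Fin 2 → ℝ) (w z : domA) : ⟪opA b w, (z : XX)⟫ = ⟪(w : XX), opA b z⟫ := by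
  have h1 := formA_eq_neg_inner b w (domA.toV z)
  have h2 := formA_eq_neg_inner b z (domA.toV w)
  rw [formA_comm, h2, neg_inj] at h1
  rw [real_inner_comm (opA b z)]
  exact h1.symm

theorem isDissipative_opA (hb : ∀ i, 0 < b i) : IsDissipative (opA b) := fun w => by
  have h1 := formA_eq_neg_inner b w (domA.toV w)
  have h2 := formA_nonneg hb (domA.toV w)
  rw [h1] at h2
  exact neg_nonneg.1 h2

theorem V.eq_zero_of_formA (hb : ∀ i, 0 < b i) {f : V} (h : formA b f f = 0) : f = 0 := by
  obtain ⟨K, -, hK⟩ := formA_coercive hb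
  have := hK f
  rw [h, mul_zero] at this
  exact Subtype.ext (norm_eq_zero.1 (pow_eq_zero_iff two_ne_zero |>.1
    (le_antisymm this (sq_nonneg _))))

theorem affH1_mem_H2 (p q : ℝ) (g : L2I) : (affH1 p (affL2 q g) : L2I) ∈ H2 := by
  refine ⟨affH1 p (affL2 q g), ?_, rfl⟩
  change weakDeriv _ ∈ H1
  rw [weakDeriv_affH1]
  exact (affH1 q g).2

theorem derivH2_affH1 (p q : ℝ) (g : L2I) :
    derivH2 ⟨affH1 p (affL2 q g), affH1_mem_H2 p q g⟩ = affH1 q g :=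
  Subtype.ext (weakDeriv_affH1 p (affL2 q g))

/-- The boundary value problem `𝔸 w = y` is solved explicitly. -/
theorem opA_surjective (hb : ∀ i, 0 < b i) (y : XX) : ∃ w : domA, opA b w = y := by
  obtain ⟨⟨g, β⟩⟩ := y
  have h0 := hb 0
  have h1 := hb 1
  set c := affInt 0 g 1 with hc
  set γ := affInt 0 (affL2 0 g) 1 with hγ
  have hD : b 0 + b 1 + b 0 * b 1 ≠ 0 := by positivity
  -- The solution is sought as `u(x) = p + ∫₀ˣ (q + ∫₀ˢ g) ds`, so `u'(0) = q`, `u'(1) = q + c`,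
  -- `u(1) = p + q + γ`. The boundary equations are `q - b₀ p = β₀` and `-(q + c) - b₁ (p + q + γ) =
  -- β₁`; eliminating `q` determines `p`, with nonzero coefficient `b₀ + b₁ + b₀ b₁`.
  set p := -(β 1 + β 0 + c + b 1 * β 0 + b 1 * γ) / (b 0 + b 1 + b 0 * b 1) with hp
  set q := b 0 * p + β 0 with hq
  have hpe : p * (b 0 + b 1 + b 0 * b 1) = -(β 1 + β 0 + c + b 1 * β 0 + b 1 * γ) := by
    rw [hp]; field_simp
  have hval : affInt p (affL2 q g) 1 = p + q + γ := by
    have e1 : affL2 q g = constL2 q + affL2 0 g := by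
      apply Lp.ext
      filter_upwards [Lp.coeFn_add (constL2 q) (affL2 0 g), constL2_coe q,
        (isContRep_affL2 0 g).2, (isContRep_affL2 q g).2] with x h1 h2 h3 h4
      rw [h1, Pi.add_apply, h2, h3, h4]
      simp [affInt]
    have e2 : ∫ t in (0 : ℝ)..1, affL2 q g t = q + ∫ t in (0 : ℝ)..1, affL2 0 g t := by
      rw [← integral_μI, ← integral_μI, e1]
      have : ∫ x, (constL2 q + affL2 0 g : L2I) x ∂μI
          = ∫ x, (q + affL2 0 g x) ∂μI := by
        refine integral_congr_ae ?_
        filter_upwards [Lp.coeFn_add (constL2 q) (affL2 0 g), constL2_coe q] with x h1 h2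
        rw [h1, Pi.add_apply, h2]
      rw [this, integral_add (integrable_const q) (L2I.integrable _)]
      simp
    simp only [hγ, affInt] at e2 ⊢
    rw [e2]
    ring
  let u : H2 := ⟨affH1 p (affL2 q g), affH1_mem_H2 p q g⟩
  let w : domA := ⟨WithLp.toLp 2 ((u : L2I), L (affH1 p (affL2 q g))), u.2, rfl⟩
  have hd : derivH2 u = affH1 q g := derivH2_affH1 p q g
  refine ⟨w, ?_⟩
  have hfst : domA.fst w = u := rfl
  have hsnd : domA.snd w = L (affH1 p (affL2 q g)) := rfl
  rw [opA_apply, hfst, hsnd]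
  have hA : Am u = g := by
    change weakDeriv (derivH2 u) = g
    rw [hd, weakDeriv_affH1]
  have e0 : evalAt pt0 (derivH2 u) = q := by rw [hd, evalAt_pt0_affH1]
  have e1 : evalAt pt1 (derivH2 u) = q + c := by
    rw [hd, evalAt_affH1]
    simp [affInt, hc, pt1]
  have hC0 : C u 0 = evalAt pt0 (derivH2 u) := rfl
  have hC1 : C u 1 = -evalAt pt1 (derivH2 u) := rfl
  have f1 : evalAt pt1 (affH1 p (affL2 q g)) = p + q + γ := by
    rw [evalAt_affH1]
    exact hval
  rw [hA]
  congr 2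
  ext i
  fin_cases i
  · simp only [Fin.zero_eta, PiLp.add_apply, hC0, e0, B_apply, L_apply_zero, evalAt_pt0_affH1]
    rw [hq]; ring
  · simp only [Fin.mk_one, PiLp.add_apply, hC1, e1, B_apply, L_apply_one, f1]
    rw [hq]; linear_combination -hpe

theorem opA_injective (hb : ∀ i, 0 < b i) {w : domA} (h : opA b w = 0) : w = 0 := by
  have h1 := formA_eq_neg_inner b w (domA.toV w)
  rw [h, inner_zero_left, neg_zero] at h1
  have : (domA.toV w : XX) = 0 := congrArg Subtype.val (V.eq_zero_of_formA hb h1)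
  exact Subtype.ext this

/-- One direction is Green's formula. For the other, solve `𝔸 w = -g`: then `f - w` is
`a`-orthogonal to all of `V`, in particular to itself, so `f = w` by coercivity. No regularity
argument for `f` is needed. -/
theorem isAssociatedWith_formA (hb : ∀ i, 0 < b i) : IsAssociatedWith (opA b) (formA b) := by
  intro f g
  rw [LinearPMap.mem_graph_iff]
  constructor
  · rintro ⟨w, rfl, hw⟩
    refine ⟨domA_le_V w.2, fun h => ?_⟩
    have := formA_eq_neg_inner b w h
    rw [hw, inner_neg_left, neg_neg] at this
    exact this
  · rintro ⟨hf, h⟩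
    obtain ⟨w, hw⟩ := opA_surjective hb (-g)
    refine ⟨w, ?_, hw⟩
    have h1 : ∀ k : V, formA b (⟨f, hf⟩ - domA.toV w) k = 0 := fun k => by
      rw [map_sub, LinearMap.sub_apply, h k, formA_eq_neg_inner, hw, inner_neg_left, neg_neg,
        sub_self]
    have h2 := sub_eq_zero.1 (V.eq_zero_of_formA hb (h1 _))
    exact (congrArg Subtype.val h2).symm

/-- If `y = 𝔸 x` is orthogonal to the domain, symmetry makes `x` orthogonal to the range of `𝔸`,
which is everything; so `x = 0` and `y = 0`. -/
theorem dense_domA (hb : ∀ i, 0 < b i) : Dense (domA : Set XX) := by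
  rw [Submodule.dense_iff_topologicalClosure_eq_top, Submodule.topologicalClosure_eq_top_iff,
    eq_bot_iff]
  intro y hy
  obtain ⟨x, rfl⟩ := opA_surjective hb y
  have h : ∀ d : domA, ⟪opA b d, (x : XX)⟫ = 0 := fun d => by
    rw [opA_symmetric]
    exact Submodule.inner_right_of_mem_orthogonal d.2 hy
  obtain ⟨d, hd⟩ := opA_surjective hb (x : XX)
  have := h d
  rw [hd, inner_self_eq_zero] at this
  have : x = 0 := Subtype.ext this
  exact (congrArg (opA b).toFun this).trans (map_zero _)

theorem dense_V (hb : ∀ i, 0 < b i) : Dense (V : Set XX) := (dense_domA hb).mono domA_le_V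

/-- A densely defined symmetric surjective operator is self-adjoint: for `y` in the domain of the
adjoint choose `x` with `𝔸 x = 𝔸* y`; then `y - x` is orthogonal to the range, so `y = x`. -/
theorem isSelfAdjoint_opA (hb : ∀ i, 0 < b i) : IsSelfAdjoint (opA b) := by
  have hd : Dense ((opA b).domain : Set XX) := dense_domA hb
  rw [LinearPMap.isSelfAdjoint_def]
  refine (LinearPMap.eq_of_le_of_domain_eq ?_ (le_antisymm ?_ ?_)).symm
  · exact LinearPMap.IsFormalAdjoint.le_adjoint hd fun x y => opA_symmetric b x y
  · exact (LinearPMap.IsFormalAdjoint.le_adjoint hd fun x y => opA_symmetric b x y).1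
  · intro y hy
    obtain ⟨x, hx⟩ := opA_surjective hb ((opA b).adjoint ⟨y, hy⟩)
    have h : ∀ d : domA, ⟪y - (x : XX), opA b d⟫ = 0 := fun d => by
      have := (LinearPMap.adjoint_isFormalAdjoint hd) ⟨y, hy⟩ d
      rw [inner_sub_left, ← this, ← opA_symmetric, hx, sub_self]
    obtain ⟨d, hdd⟩ := opA_surjective hb (y - (x : XX))
    have := h d
    rw [hdd, inner_self_eq_zero, sub_eq_zero] at this
    rw [this]
    exact x.2

end Operator
-- Compactness from Hölder bounds
section Compactness

open scoped BoundedContinuousFunction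

/-- A bounded set in the Hölder space of exponent `1/2` on `[0,1]`. -/
def holderBall (N : ℝ) : Set (Icc (0 : ℝ) 1 →ᵇ ℝ) :=
  {f | (∀ x, |f x| ≤ N) ∧ ∀ x y, |f x - f y| ≤ √|(x : ℝ) - y| * N}

/-- Arzelà–Ascoli: the common modulus `√|t| * N` gives equicontinuity, and the set is closed because
its conditions are pointwise. -/
theorem isCompact_holderBall (N : ℝ) : IsCompact (holderBall N) := by
  refine BoundedContinuousFunction.arzela_ascoli₂ (Icc (-N) N) isCompact_Icc _ ?_
    (fun f x hf => abs_le.1 (hf.1 x)) ?_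
  · have h1 : ∀ x : Icc (0 : ℝ) 1, Continuous fun f : Icc (0 : ℝ) 1 →ᵇ ℝ => f x := fun x =>
      (continuous_apply x).comp BoundedContinuousFunction.continuous_coe
    rw [holderBall, ofPred_and]
    refine IsClosed.inter ?_ ?_
    · simp only [ofPred_forall]
      exact isClosed_iInter fun x => isClosed_le (h1 x).abs continuous_const
    · simp only [ofPred_forall]
      exact isClosed_iInter fun x => isClosed_iInter fun y =>
        isClosed_le ((h1 x).sub (h1 y)).abs continuous_const
  · refine Metric.equicontinuous_of_continuity_modulus (fun t => √|t| * N) ?_ _ fun x y f => ?_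
    · have : Continuous fun t : ℝ => √|t| * N := by fun_prop
      simpa using this.tendsto 0
    · have := f.2.2 x y
      rw [Real.dist_eq, Subtype.dist_eq, Real.dist_eq, abs_abs]
      exact this

/-- The embedding of the continuous functions on `[0,1]` into `L²(0,1)`. -/
def embedL2 (f : Icc (0 : ℝ) 1 →ᵇ ℝ) : L2I :=
  BoundedContinuousFunction.toLp 2 μI ℝ
    (f.compContinuous ⟨projIcc 0 1 zero_le_one, continuous_projIcc⟩)

theorem continuous_embedL2 : Continuous embedL2 :=
  (BoundedContinuousFunction.toLp 2 μI ℝ).continuous.comp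
    (BoundedContinuousFunction.continuous_compContinuous _)

/-- The elements of `H¹(0,1)` with bounded boundary value and derivative lie in a compact subset
of `L²(0,1)`. -/
theorem mem_image_holderBall {u : H1} {N : ℝ} (h : |evalAt pt0 u| + ‖weakDeriv u‖ ≤ N) :
    (u : L2I) ∈ embedL2 '' holderBall N := by
  have hc : Continuous fun x : Icc (0 : ℝ) 1 => evalAt x u :=
    continuousOn_iff_continuous_domRestrict.1 (contRep_spec u).1
  let f : Icc (0 : ℝ) 1 →ᵇ ℝ := BoundedContinuousFunction.mkOfCompact ⟨_, hc⟩
  have hf : ∀ x, f x = evalAt x u := fun x => rfl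
  refine ⟨f, ⟨fun x => (abs_evalAt_le u x).trans h, fun x y => ?_⟩, ?_⟩
  · refine (abs_evalAt_sub_le u x y).trans (mul_le_mul_of_nonneg_left ?_ (Real.sqrt_nonneg _))
    linarith [abs_nonneg (evalAt pt0 u)]
  · apply Lp.ext
    filter_upwards [BoundedContinuousFunction.coeFn_toLp (p := 2) (μ := μI) ℝ
      (f.compContinuous ⟨projIcc 0 1 zero_le_one, continuous_projIcc⟩), (contRep_spec u).2,
      ae_restrict_mem measurableSet_Ioo] with x h1 h2 h3
    rw [h2]
    refine h1.trans ?_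
    change f (projIcc 0 1 zero_le_one x) = _
    rw [projIcc_of_mem _ (Ioo_subset_Icc_self h3)]
    rfl

/-- The image of the unit ball lies in a product of two compact sets: a Hölder ball embedded in
`L²`, and a closed ball of the finite-dimensional boundary space. -/
theorem isCompactOperator_of_weakDeriv_bound {R : XX →L[ℝ] XX} {M : ℝ}
    (hR : ∀ y, ∃ f : V, R y = f ∧ ‖weakDeriv (V.fst f)‖ ≤ M * ‖y‖) : IsCompactOperator R := by
  have hM : ∀ y : XX, ‖y‖ ≤ 1 → M * ‖y‖ ≤ |M| := fun y hy =>
    (mul_le_mul_of_nonneg_right (le_abs_self M) (norm_nonneg y)).trans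
      (mul_le_of_le_one_right (abs_nonneg M) hy)
  -- `‖R‖` bounds the trace `u(0)`, which is a coordinate of `R y`, and `|M|` bounds the derivative.
  set N := ‖R‖ + |M|
  refine ⟨(WithLp.toLp 2 : L2I × R2 → XX) ''
    ((embedL2 '' holderBall N) ×ˢ Metric.closedBall (0 : R2) ‖R‖), ?_, ?_⟩
  · exact (((isCompact_holderBall N).image continuous_embedL2).prod
      (isCompact_closedBall _ _)).image (WithLp.prod_continuous_toLp 2 _ _)
  · filter_upwards [Metric.closedBall_mem_nhds (0 : XX) one_pos] with y hy
    rw [mem_closedBall_zero_iff] at hy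
    obtain ⟨f, hf, hfd⟩ := hR y
    have hn : ‖(f : XX)‖ ≤ ‖R‖ := by
      rw [← hf]
      exact (R.le_opNorm y).trans (mul_le_of_le_one_right (norm_nonneg _) hy)
    have hsq := norm_sq_V f
    have h0 : |evalAt pt0 (V.fst f)| ≤ ‖(f : XX)‖ := by
      refine abs_le_of_sq_le_sq ?_ (norm_nonneg _)
      nlinarith [sq_nonneg (evalAt pt1 (V.fst f)), sq_nonneg ‖(V.fst f : L2I)‖]
    have h1 : ‖(f : XX).snd‖ ≤ ‖(f : XX)‖ := by
      rw [← sq_le_sq₀ (norm_nonneg _) (norm_nonneg _), WithLp.prod_norm_sq_eq_of_L2 (f : XX)]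
      linarith [sq_nonneg ‖(f : XX).fst‖]
    refine ⟨((f : XX).fst, (f : XX).snd), ⟨?_, ?_⟩, hf.symm⟩
    · exact mem_image_holderBall (u := V.fst f)
        (add_le_add (h0.trans hn) (hfd.trans (hM y hy)))
    · rw [mem_closedBall_zero_iff]
      exact h1.trans hn

end Compactness

/-! ### The compact inverse of `-𝔸` and the resolvent -/

section Inverse

variable {b : Fin 2 → ℝ}

/-- Coercivity gives `‖w‖² ≤ K a(w,w) ≤ K ‖𝔸 w‖ ‖w‖`, hence `‖w‖ ≤ K ‖𝔸 w‖`; inserting this into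
`‖u'‖² ≤ a(w,w)` gives `‖u'‖² ≤ K ‖𝔸 w‖²`. The constant `K + 1` serves both, since `K ≤ (K + 1)²`.
-/
theorem opA_bounded_below (hb : ∀ i, 0 < b i) : ∃ M, 0 ≤ M ∧ ∀ w : domA,
    ‖(w : XX)‖ ≤ M * ‖opA b w‖ ∧ ‖weakDeriv (V.fst (domA.toV w))‖ ≤ M * ‖opA b w‖ := by
  obtain ⟨K, hK, h⟩ := formA_coercive hb
  refine ⟨K + 1, by positivity, fun w => ?_⟩
  have h1 := h (domA.toV w)
  have h2 : formA b (domA.toV w) (domA.toV w) ≤ ‖opA b w‖ * ‖(w : XX)‖ := by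
    rw [formA_eq_neg_inner, ← inner_neg_left, ← norm_neg (opA b w)]
    exact real_inner_le_norm _ _
  have h3 := norm_weakDeriv_sq_le_formA hb (domA.toV w)
  have hw : ‖(w : XX)‖ ≤ K * ‖opA b w‖ := by
    rcases (norm_nonneg (w : XX)).eq_or_lt with h0 | h0
    · rw [← h0]; positivity
    · have h4 : ‖(w : XX)‖ ^ 2 ≤ K * (‖opA b w‖ * ‖(w : XX)‖) :=
        h1.trans (mul_le_mul_of_nonneg_left h2 hK.le)
      nlinarith
  have n1 := norm_nonneg (opA b w)
  refine ⟨by nlinarith, ?_⟩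
  rw [← sq_le_sq₀ (norm_nonneg _) (by positivity)]
  calc _ ≤ ‖opA b w‖ * (K * ‖opA b w‖) :=
        h3.trans (h2.trans (mul_le_mul_of_nonneg_left hw n1))
    _ ≤ _ := by nlinarith [mul_nonneg hK.le (sq_nonneg ‖opA b w‖), sq_nonneg ‖opA b w‖,
        mul_nonneg (sq_nonneg K) (sq_nonneg ‖opA b w‖)]

/-- The operator `-𝔸` has a compact, symmetric, positive definite inverse. -/
theorem exists_inverse (hb : ∀ i, 0 < b i) : ∃ R : XX →L[ℝ] XX,
    IsCompactOperator R ∧ (∀ x y, ⟪R x, y⟫ = ⟪x, R y⟫) ∧ (∀ x, x ≠ 0 → 0 < ⟪R x, x⟫) ∧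
      ∀ x y, (x, y) ∈ (opA b).graph ↔ x = -R y := by
  obtain ⟨M, hM, hbd⟩ := opA_bounded_below hb
  let e : domA ≃ₗ[ℝ] XX := LinearEquiv.ofBijective (opA b).toFun
    ⟨(injective_iff_map_eq_zero _).2 fun w hw => opA_injective hb hw, opA_surjective hb⟩
  have he : ∀ w : domA, e w = opA b w := fun w => rfl
  let R : XX →L[ℝ] XX := -LinearMap.mkContinuous (domA.subtype ∘ₗ e.symm.toLinearMap) M
    fun y => by
      have := (hbd (e.symm y)).1
      rwa [← he, LinearEquiv.apply_symm_apply] at this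
  have hR : ∀ y, R y = -(e.symm y : XX) := fun y => rfl
  have hRA : ∀ w : domA, R (opA b w) = -(w : XX) := fun w => by
    rw [hR, ← he, LinearEquiv.symm_apply_apply]
  refine ⟨R, ?_, fun x y => ?_, fun x hx => ?_, fun x y => ?_⟩
  · refine isCompactOperator_of_weakDeriv_bound (M := M) fun y =>
      ⟨-domA.toV (e.symm y), hR y, ?_⟩
    have := (hbd (e.symm y)).2
    rw [← he, LinearEquiv.apply_symm_apply] at this
    rwa [map_neg, map_neg, norm_neg]
  · obtain ⟨w, rfl⟩ := opA_surjective hb x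
    obtain ⟨z, rfl⟩ := opA_surjective hb y
    rw [hRA, hRA, inner_neg_left, inner_neg_right, opA_symmetric]
  · obtain ⟨w, rfl⟩ := opA_surjective hb x
    have h1 := formA_eq_neg_inner b w (domA.toV w)
    rw [hRA, inner_neg_left, real_inner_comm]
    change 0 < -⟪opA b w, (domA.toV w : XX)⟫
    rw [← h1]
    refine lt_of_le_of_ne (formA_nonneg hb _) fun h => hx ?_
    have : (domA.toV w : XX) = 0 := congrArg Subtype.val (V.eq_zero_of_formA hb h.symm)
    have hw : w = 0 := Subtype.ext this
    exact (congrArg (opA b).toFun hw).trans (map_zero _)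
  · rw [LinearPMap.mem_graph_iff]
    constructor
    · rintro ⟨w, rfl, rfl⟩
      exact (neg_eq_iff_eq_neg.2 (hRA w)).symm
    · rintro rfl
      exact ⟨e.symm y, by rw [hR, neg_neg], e.apply_symm_apply y⟩

/-- An operator whose negative has a compact inverse has compact resolvent. -/
theorem hasCompactResolvent_of_inverse {H : Type*} [NormedAddCommGroup H]
    [InnerProductSpace ℝ H] {A : H →ₗ.[ℝ] H} {R : H →L[ℝ] H} (hc : IsCompactOperator R)
    (hA : ∀ x y, (x, y) ∈ A.graph ↔ x = -R y) : HasCompactResolvent A := by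
  have hA' : ∀ x : A.domain, (x : H) = -R (A x) := fun x => (hA _ _).1 (A.mem_graph x)
  -- `R` is itself the resolvent at `0`, so the resolvent set is nonempty.
  refine ⟨⟨0, R, fun y => ?_, fun x => ?_⟩, fun l S hS => ?_⟩
  · have : (R y, -y) ∈ A.graph := (hA _ _).2 (by rw [map_neg, neg_neg])
    obtain ⟨x, hx : (x : H) = R y, hy : A x = -y⟩ := (LinearPMap.mem_graph_iff _).1 this
    have hm : R y ∈ A.domain := by
      rw [← hx]
      exact x.2
    have hx' : (⟨R y, hm⟩ : A.domain) = x := Subtype.ext hx.symm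
    exact ⟨hm, by rw [hx', hy, zero_smul, zero_sub, neg_neg]⟩
  · rw [zero_smul, zero_sub, map_neg, ← hA' x]
  -- The resolvent identity between `0` and `l`: from `y - l S y = -A (S y)` one gets `S = R (1 - l
  -- S)`, compact because `R` is.
  · have : S = R.comp (ContinuousLinearMap.id ℝ H - l • S) := by
      ext y
      obtain ⟨hm, hy⟩ := hS.1 y
      have h1 := hA' ⟨S y, hm⟩
      have h2 : y - l • S y = -A ⟨S y, hm⟩ := by
        nth_rw 1 [← hy]
        abel
      simp only [ContinuousLinearMap.comp_apply, sub_apply,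
        ContinuousLinearMap.id_apply, smul_apply]
      rw [h2, map_neg]
      exact h1
    rw [this]
    exact hc.comp_clm _

end Inverse
end DynBdry

end

theorem mainTheorem2 (b : Fin 2 → ℝ) (hb : ∀ i, 0 < b i) :
    (∃ T : ℝ≥0 → DynBdry.XX →L[ℝ] DynBdry.XX,
      DynBdry.IsC0Semigroup T ∧
      DynBdry.IsGenerator (DynBdry.opA b) T ∧
      (∀ t, ‖T t‖ ≤ 1) ∧
      DynBdry.IsAnalyticSemigroup (Real.pi / 2) T ∧
      (∀ t, IsSelfAdjoint (T t)) ∧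
      (∀ t, 0 < t → IsCompactOperator (T t))) ∧
    (IsSelfAdjoint (DynBdry.opA b) ∧
      DynBdry.IsDissipative (DynBdry.opA b) ∧
      DynBdry.HasCompactResolvent (DynBdry.opA b)) ∧
    (Dense (DynBdry.V : Set DynBdry.XX) ∧
      (∀ f g, DynBdry.formA b f g = DynBdry.formA b g f) ∧
      (∀ f, 0 ≤ DynBdry.formA b f f) ∧
      DynBdry.IsContinuousForm (DynBdry.formA b) ∧
      DynBdry.IsClosedForm (DynBdry.formA b) ∧
      DynBdry.IsAssociatedWith (DynBdry.opA b) (DynBdry.formA b)) := by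
  obtain ⟨R, hc, hs, hpos, hA⟩ := DynBdry.exists_inverse hb
  exact ⟨DynBdry.exists_semigroup_of_compact hc hs hpos hA,
    ⟨DynBdry.isSelfAdjoint_opA hb, DynBdry.isDissipative_opA hb,
      DynBdry.hasCompactResolvent_of_inverse hc hA⟩,
    DynBdry.dense_V hb, DynBdry.formA_comm b, DynBdry.formA_nonneg hb,
    DynBdry.isContinuousForm_formA hb, DynBdry.isClosedForm_formA hb,
    DynBdry.isAssociatedWith_formA hb⟩
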